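/- Let $G=\mathrm{SO}(4)$ and $K=\mathrm{SO}(3)$, embedded in $G$ by $k\mapsto\mathrm{diag}(k,1)$. Put $L_{ij}=E_{ij}-E_{ji}\in\mathfrak{so}(4)$, $$Y_1=L_{12},\ Y_2=L_{13},\ Y_3=L_{23},\ Y_4=L_{14},\ Y_5=L_{24},\ Y_6=L_{34},$$ $$Z_1=\tfrac12(Y_3+Y_4),\ Z_2=\tfrac12(Y_2-Y_5),\ Z_3=\tfrac12(Y_1+Y_6),\ Z_4=\tfrac12(Y_3-Y_4),\ Z_5=\tfrac12(Y_2+Y_5),\ Z_6=\tfrac12(Y_1-Y_6).$$ An element $X\in\mathfrak{so}(4)$ acts on smooth functions on $G$ as a left invariant vector field, $(Xf)(g)=\frac{d}{dt}\big|_{t=0}f(g\exp tX)$. The Casimir operators of the two summands of $\mathfrak{so}(4)\simeq\mathfrak{so}(3)\oplus\mathfrak{so}(3)$ are $$\Delta_1=-Z_4^2-Z_5^2-Z_6^2,\qquad \Delta_2=-Z_1^2-Z_2^2-Z_3^2 .$$ Let $\ell\ge 0$ be an even integer and let $\pi_\ell$ be the irreducible representation of $K$ whose pull-back under a double covering $\mathrm{SU}(2)\to\mathrm{SO}(3)$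 is equivalent to the representation $(A\cdot p)(z)=p(A^{-1}z)$ on complex homogeneous polynomials of degree $\ell$ in two variables. Let $m_1,m_2$ be integers with $m_1\ge \ell/2\ge|m_2|$. Let $\tau=\tau_{(m_1,m_2)}$ be a continuous irreducible finite-dimensional complex representation of $G$, on a space $V$, with highest weight $m_1\varepsilon_1+m_2\varepsilon_2$; here $\varepsilon_j(x_1L_{12}+x_2L_{34})=-i x_j$ and the positive roots are $\varepsilon_1-\varepsilon_2$ and $\varepsilon_1+\varepsilon_2$. With $\chi_\ell=(\ell+1)\,\mathrm{tr}\,\pi_\ell$ and $dk$ the Haar measure of $K$ of total mass $1$, put $$P_\ell=\int_K\chi_\ell(k^{-1})\,\tau(k)\,dk,\qquad V(\ell)=P_\ell V,\qquad \Phi_\ell^{(m_1,m_2)}(g)\,a=P_\ell\,\tau(g)\,a\quad(g\in G,\ a\in V(\ell)).$$ Then $\Phi=\Phi_\ell^{(m_1,m_2)}:G\to\mathrm{End}(V(\ell))$ is a spherical function of type $\pi_\ell$, that is, it is continuous, $\Phi(e)=I$, and $\Phi(x)\Phi(y)=\int_K\chi_\ell(k^{-1})\Phi(xky)\,dk$ for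 all $x,y\in G$. Moreover $\Phi$ is $C^\infty$ on $G$, and $$\Delta_1\Phi=\tfrac14(m_1-m_2)(m_1-m_2+2)\,\Phi,\qquad \Delta_2\Phi=\tfrac14(m_1+m_2)(m_1+m_2+2)\,\Phi .$$ -/

import Mathlib

open scoped Matrix ContDiff

noncomputable section

namespace SphericalSO4

/-! ### The groups `G = SO(4)` and `K = SO(3)` -/

/-- The group `G = SO(4)`, with the topology induced from the real matrices. -/
abbrev SO4 : Type := Matrix.specialOrthogonalGroup (Fin 4) ℝ

/-- The group `K = SO(3)`, with the topology induced from the real matrices. -/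
abbrev SO3 : Type := Matrix.specialOrthogonalGroup (Fin 3) ℝ

/-- The group `SU(2)`, with the topology induced from the complex matrices. -/
abbrev SU2 : Type := Matrix.specialUnitaryGroup (Fin 2) ℂ

instance instTopologicalGroupSO3 : IsTopologicalGroup SO3 where
  continuous_inv :=
    Continuous.subtype_mk (continuous_star.comp continuous_subtype_val) _

instance instCompactSpaceSO3 : CompactSpace SO3 := by
  have hc : IsCompact
      (Set.pi Set.univ fun _ : Fin 3 => Set.pi Set.univ fun _ : Fin 3 => Set.Icc (-1 : ℝ) 1) :=
    isCompact_univ_pi fun _ => isCompact_univ_pi fun _ => isCompact_Icc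
  have hcl : IsClosed {A : Matrix (Fin 3) (Fin 3) ℝ |
      A ∈ Matrix.specialOrthogonalGroup (Fin 3) ℝ} := by
    have h1 : IsClosed {A : Matrix (Fin 3) (Fin 3) ℝ | A * star A = 1} :=
      isClosed_eq (by fun_prop) continuous_const
    have h2 : IsClosed {A : Matrix (Fin 3) (Fin 3) ℝ | A.det = 1} :=
      isClosed_eq (continuous_id.matrix_det) continuous_const
    convert h1.inter h2 using 1
    ext A
    simp [Matrix.mem_specialOrthogonalGroup_iff, Matrix.mem_orthogonalGroup_iff,
      Matrix.star_eq_conjTranspose]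
  refine isCompact_iff_compactSpace.mp (hc.of_isClosed_subset hcl ?_)
  intro A hA i _ j _
  have h := entry_norm_bound_of_unitary
    (Matrix.mem_specialOrthogonalGroup_iff.mp hA).1 i j
  rw [Real.norm_eq_abs, abs_le] at h
  exact h

instance instMeasurableSpaceSO3 : MeasurableSpace SO3 := borel SO3

instance instBorelSpaceSO3 : BorelSpace SO3 := ⟨rfl⟩

/-- The Haar measure `dk` of `K = SO(3)` with total mass `1`. -/
def haarSO3 : MeasureTheory.Measure SO3 := MeasureTheory.Measure.haarMeasure ⊤

/-- The inclusion `K → G`, `k ↦ diag(k, 1)`. -/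
def incl : SO3 →* SO4 where
  toFun k := ⟨Matrix.reindex finSumFinEquiv finSumFinEquiv
      (Matrix.fromBlocks (k : Matrix (Fin 3) (Fin 3) ℝ) 0 0 (1 : Matrix (Fin 1) (Fin 1) ℝ)), by
    have hk := Matrix.mem_specialOrthogonalGroup_iff.mp k.2
    have h1 := (Matrix.mem_orthogonalGroup_iff _ _).mp hk.1
    rw [Matrix.mem_specialOrthogonalGroup_iff, Matrix.mem_orthogonalGroup_iff]
    refine ⟨?_, ?_⟩
    · rw [Matrix.transpose_reindex, Matrix.reindex_apply, Matrix.reindex_apply,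
        Matrix.submatrix_mul_equiv, Matrix.fromBlocks_transpose, Matrix.fromBlocks_multiply]
      simp [h1]
    · rw [Matrix.det_reindex_self, Matrix.det_fromBlocks_zero₂₁]
      simp [hk.2]⟩
  map_one' := by
    apply Subtype.ext
    simp
  map_mul' k k' := by
    apply Subtype.ext
    simp [Matrix.submatrix_mul_equiv, Matrix.fromBlocks_multiply]

/-! ### The Lie algebra `𝔰𝔬(4)` and left invariant differential operators on `G` -/

/-- The skew-symmetric matrix `E_{ij} - E_{ji}`. -/
def skewUnit (R : Type) [CommRing R] (i j : Fin 4) : LieAlgebra.Orthogonal.so (Fin 4) R :=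
  ⟨Matrix.single i j 1 - Matrix.single j i 1, by
    rw [LieAlgebra.Orthogonal.mem_so]
    simp [Matrix.transpose_sub, Matrix.transpose_single]⟩

/-- The basis `Y₁, …, Y₆` of `𝔰𝔬(4)` (here indexed from `0`):
`E₁₂ - E₂₁`, `E₁₃ - E₃₁`, `E₂₃ - E₃₂`, `E₁₄ - E₄₁`, `E₂₄ - E₄₂`, `E₃₄ - E₄₃`. -/
def Y (R : Type) [CommRing R] : Fin 6 → LieAlgebra.Orthogonal.so (Fin 4) R :=
  ![skewUnit R 0 1, skewUnit R 0 2, skewUnit R 1 2, skewUnit R 0 3, skewUnit R 1 3, skewUnit R 2 3]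

/-- `Z₁ = (Y₃ + Y₄)/2`. -/
def Z1 : LieAlgebra.Orthogonal.so (Fin 4) ℝ := (1 / 2 : ℝ) • (Y ℝ 2 + Y ℝ 3)
/-- `Z₂ = (Y₂ - Y₅)/2`. -/
def Z2 : LieAlgebra.Orthogonal.so (Fin 4) ℝ := (1 / 2 : ℝ) • (Y ℝ 1 - Y ℝ 4)
/-- `Z₃ = (Y₁ + Y₆)/2`. -/
def Z3 : LieAlgebra.Orthogonal.so (Fin 4) ℝ := (1 / 2 : ℝ) • (Y ℝ 0 + Y ℝ 5)
/-- `Z₄ = (Y₃ - Y₄)/2`. -/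
def Z4 : LieAlgebra.Orthogonal.so (Fin 4) ℝ := (1 / 2 : ℝ) • (Y ℝ 2 - Y ℝ 3)
/-- `Z₅ = (Y₂ + Y₅)/2`. -/
def Z5 : LieAlgebra.Orthogonal.so (Fin 4) ℝ := (1 / 2 : ℝ) • (Y ℝ 1 + Y ℝ 4)
/-- `Z₆ = (Y₁ - Y₆)/2`. -/
def Z6 : LieAlgebra.Orthogonal.so (Fin 4) ℝ := (1 / 2 : ℝ) • (Y ℝ 0 - Y ℝ 5)

theorem exp_mem_orthogonal (X : LieAlgebra.Orthogonal.so (Fin 4) ℝ) :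
    NormedSpace.exp (X : Matrix (Fin 4) (Fin 4) ℝ) ∈ Matrix.orthogonalGroup (Fin 4) ℝ := by
  have hX := (LieAlgebra.Orthogonal.mem_so (Fin 4) ℝ _).mp X.2
  rw [Matrix.mem_orthogonalGroup_iff, ← Matrix.exp_transpose, hX,
    ← Matrix.exp_add_of_commute _ _ (Commute.refl (X : Matrix (Fin 4) (Fin 4) ℝ)).neg_right]
  simp

/-- The exponential map `𝔰𝔬(4) → SO(4)`. -/
def expSO4 (X : LieAlgebra.Orthogonal.so (Fin 4) ℝ) : SO4 :=
  ⟨NormedSpace.exp (X : Matrix (Fin 4) (Fin 4) ℝ), by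
    refine Matrix.mem_specialOrthogonalGroup_iff.mpr ⟨exp_mem_orthogonal X, ?_⟩
    have h2 : (X : Matrix (Fin 4) (Fin 4) ℝ) =
        (((1 / 2 : ℝ) • X : LieAlgebra.Orthogonal.so (Fin 4) ℝ) : Matrix (Fin 4) (Fin 4) ℝ) +
        (((1 / 2 : ℝ) • X : LieAlgebra.Orthogonal.so (Fin 4) ℝ) : Matrix (Fin 4) (Fin 4) ℝ) := by
      change _ = (1 / 2 : ℝ) • (X : Matrix (Fin 4) (Fin 4) ℝ) + (1 / 2 : ℝ) • (X : Matrix _ _ ℝ)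
      rw [← add_smul]
      norm_num
    have h3 := congrArg Matrix.det ((Matrix.mem_orthogonalGroup_iff _ _).mp
      (exp_mem_orthogonal ((1 / 2 : ℝ) • X)))
    rw [Matrix.det_mul, Matrix.det_transpose, Matrix.det_one] at h3
    rw [h2, Matrix.exp_add_of_commute _ _ (Commute.refl _), Matrix.det_mul]
    exact h3⟩

section Operators

variable {E : Type*} [NormedAddCommGroup E] [NormedSpace ℝ E]

/-- The left invariant vector field defined by `X ∈ 𝔰𝔬(4)`:
`(X f)(g) = d/dt|_{t=0} f(g exp(tX))`. -/
def leftInvDeriv (X : LieAlgebra.Orthogonal.so (Fin 4) ℝ) (f : SO4 → E) : SO4 → E :=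
  fun g => deriv (fun t : ℝ => f (g * expSO4 (t • X))) 0

/-- `Δ₁ = -Z₄² - Z₅² - Z₆²`, the Casimir operator of the first summand `𝔰𝔬(3)`. -/
def Delta1 (f : SO4 → E) : SO4 → E := fun g =>
  -leftInvDeriv Z4 (leftInvDeriv Z4 f) g - leftInvDeriv Z5 (leftInvDeriv Z5 f) g
    - leftInvDeriv Z6 (leftInvDeriv Z6 f) g

/-- `Δ₂ = -Z₁² - Z₂² - Z₃²`, the Casimir operator of the second summand `𝔰𝔬(3)`. -/
def Delta2 (f : SO4 → E) : SO4 → E := fun g =>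
  -leftInvDeriv Z1 (leftInvDeriv Z1 f) g - leftInvDeriv Z2 (leftInvDeriv Z2 f) g
    - leftInvDeriv Z3 (leftInvDeriv Z3 f) g

/-- `f` is a `C^∞` function on `SO(4)`: it is `C^∞` in the exponential coordinates centred at every
point `g`. -/
def IsSmooth (f : SO4 → E) : Prop :=
  ∀ g : SO4, ContDiff ℝ ∞ fun c : Fin 6 → ℝ => f (g * expSO4 (∑ i, c i • Y ℝ i))

end Operators

/-! ### Representations of `SO(4)` and highest weights -/

section Weights

variable {V : Type*} [NormedAddCommGroup V] [NormedSpace ℂ V] [FiniteDimensional ℂ V]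

/-- The operator `τ(g)` as a continuous linear map of the finite-dimensional space `V`. -/
def op {G : Type*} [Group G] (τ : Representation ℂ G V) (g : G) : V →L[ℂ] V :=
  LinearMap.toContinuousLinearMap (τ g)

/-- A continuous irreducible finite-dimensional complex representation. -/
def IsContIrrep {G : Type*} [Group G] [TopologicalSpace G] (τ : Representation ℂ G V) : Prop :=
  Continuous (op τ) ∧ τ.IsIrreducible

/-- The derived representation `τ̇` of `𝔰𝔬(4)`. -/
def derivRep (τ : Representation ℂ SO4 V) (X : LieAlgebra.Orthogonal.so (Fin 4) ℝ) : V →L[ℂ] V :=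
  deriv (fun t : ℝ => op τ (expSO4 (t • X))) 0

/-- The real part of a matrix in `𝔰𝔬(4, ℂ)`. -/
def rePart (X : LieAlgebra.Orthogonal.so (Fin 4) ℂ) : LieAlgebra.Orthogonal.so (Fin 4) ℝ :=
  ⟨(X : Matrix (Fin 4) (Fin 4) ℂ).map Complex.re, by
    have hX := (LieAlgebra.Orthogonal.mem_so (Fin 4) ℂ _).mp X.2
    rw [LieAlgebra.Orthogonal.mem_so, ← Matrix.transpose_map, hX]
    ext i j
    simp⟩

/-- The imaginary part of a matrix in `𝔰𝔬(4, ℂ)`. -/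
def imPart (X : LieAlgebra.Orthogonal.so (Fin 4) ℂ) : LieAlgebra.Orthogonal.so (Fin 4) ℝ :=
  ⟨(X : Matrix (Fin 4) (Fin 4) ℂ).map Complex.im, by
    have hX := (LieAlgebra.Orthogonal.mem_so (Fin 4) ℂ _).mp X.2
    rw [LieAlgebra.Orthogonal.mem_so, ← Matrix.transpose_map, hX]
    ext i j
    simp⟩

/-- The derived representation `τ̇`, extended complex linearly to `𝔰𝔬(4, ℂ)`. -/
def derivRepC (τ : Representation ℂ SO4 V) (X : LieAlgebra.Orthogonal.so (Fin 4) ℂ) : V →L[ℂ] V :=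
  derivRep τ (rePart X) + Complex.I • derivRep τ (imPart X)

/-- The element `x₁ (E₁₂ - E₂₁) + x₂ (E₃₄ - E₄₃)` of the Cartan subalgebra `𝔥_ℂ`. -/
def cartan (x₁ x₂ : ℂ) : LieAlgebra.Orthogonal.so (Fin 4) ℂ := x₁ • Y ℂ 0 + x₂ • Y ℂ 5

/-- The value at `cartan x₁ x₂` of the weight `m₁ ε₁ + m₂ ε₂`, where `ε_j` is `-i x_j`. -/
def weight (m₁ m₂ : ℤ) (x₁ x₂ : ℂ) : ℂ := m₁ * (-Complex.I * x₁) + m₂ * (-Complex.I * x₂)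

/-- `X` lies in the root space of the root `n₁ ε₁ + n₂ ε₂`. -/
def InRootSpace (n₁ n₂ : ℤ) (X : LieAlgebra.Orthogonal.so (Fin 4) ℂ) : Prop :=
  ∀ x₁ x₂ : ℂ, ⁅cartan x₁ x₂, X⁆ = weight n₁ n₂ x₁ x₂ • X

/-- `τ` has highest weight `m₁ ε₁ + m₂ ε₂` with respect to the positive roots `ε₁ - ε₂`, `ε₁ + ε₂`:
there is a nonzero vector of this weight which is annihilated by all positive root vectors. -/
def HasHighestWeight (τ : Representation ℂ SO4 V) (m₁ m₂ : ℤ) : Prop :=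
  ∃ v : V, v ≠ 0 ∧
    (∀ x₁ x₂ : ℂ, derivRepC τ (cartan x₁ x₂) v = weight m₁ m₂ x₁ x₂ • v) ∧
    ∀ X : LieAlgebra.Orthogonal.so (Fin 4) ℂ,
      InRootSpace 1 (-1) X ∨ InRootSpace 1 1 X → derivRepC τ X v = 0

end Weights

/-! ### The representations `π_ℓ` of `SO(3)` -/

/-- The polynomial `z ↦ p (A z)` in two variables. -/
def polySubst (A : Matrix (Fin 2) (Fin 2) ℂ) (p : MvPolynomial (Fin 2) ℂ) :
    MvPolynomial (Fin 2) ℂ :=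
  MvPolynomial.aeval (fun i => ∑ j, MvPolynomial.C (A i j) * MvPolynomial.X j) p

/-- `π` belongs to the class of `π_ℓ`: composed with a continuous homomorphism of `SU(2)` onto
`SO(3)` with kernel `{1, -1}`, it is equivalent to the representation `(A · p)(z) = p(A⁻¹ z)` of
`SU(2)` on the homogeneous polynomials of degree `ℓ` in two variables. -/
def IsPi {W : Type*} [AddCommGroup W] [Module ℂ W] (ℓ : ℕ) (π : Representation ℂ SO3 W) : Prop :=
  ∃ ρ : SU2 →* SO3, Continuous ρ ∧ Function.Surjective ρ ∧
    (∀ A : SU2, ρ A = 1 ↔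
      (A : Matrix (Fin 2) (Fin 2) ℂ) = 1 ∨ (A : Matrix (Fin 2) (Fin 2) ℂ) = -1) ∧
    ∃ T : W ≃ₗ[ℂ] MvPolynomial.homogeneousSubmodule (Fin 2) ℂ ℓ, ∀ (A : SU2) (w : W),
      (T (π (ρ A) w) : MvPolynomial (Fin 2) ℂ) =
        polySubst ((A⁻¹ : SU2) : Matrix (Fin 2) (Fin 2) ℂ) (T w)

/-! ### Spherical functions -/

section Spherical

variable {W : Type*} [NormedAddCommGroup W] [NormedSpace ℂ W] [FiniteDimensional ℂ W]
variable {V : Type*} [NormedAddCommGroup V] [NormedSpace ℂ V] [FiniteDimensional ℂ V]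

/-- `χ_δ`, that is, the dimension of `δ` times the character of `δ`, for the class `δ` of `π`. -/
def chi (π : Representation ℂ SO3 W) (k : SO3) : ℂ := Module.finrank ℂ W * π.character k

/-- `Φ` is a spherical function on `G` of type `δ`, for the class `δ` of `π`: it is continuous,
`Φ(e) = I`, and `Φ(x) Φ(y) = ∫_K χ_δ(k⁻¹) Φ(x k y) dk` for all `x, y ∈ G`. -/
def IsSphericalFunction (π : Representation ℂ SO3 W) (Φ : SO4 → V →L[ℂ] V) : Prop :=
  Continuous Φ ∧ Φ 1 = 1 ∧
    ∀ x y : SO4, Φ x * Φ y = ∫ k, chi π k⁻¹ • Φ (x * incl k * y) ∂haarSO3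

/-- `P(δ) = ∫_K χ_δ(k⁻¹) τ(k) dk`, for the class `δ` of `π`. -/
def isoProj (π : Representation ℂ SO3 W) (τ : Representation ℂ SO4 V) : V →L[ℂ] V :=
  ∫ k, chi π k⁻¹ • op τ (incl k) ∂haarSO3

/-- The isotypic component `V(δ) = P(δ) V`, for the class `δ` of `π`. -/
abbrev isoComp (π : Representation ℂ SO3 W) (τ : Representation ℂ SO4 V) : Submodule ℂ V :=
  (isoProj π τ).range

/-- The function `Φ : G → End(V(δ))`, `Φ(g) a = P(δ) τ(g) a`, associated to `τ` and to the class `δ`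
of `π`. -/
def sphericalFunction (π : Representation ℂ SO3 W) (τ : Representation ℂ SO4 V) (g : SO4) :
    isoComp π τ →L[ℂ] isoComp π τ :=
  ((isoProj π τ).codRestrict (isoComp π τ) fun v => ⟨v, rfl⟩) ∘L op τ g ∘L (isoComp π τ).subtypeL

end Spherical

end SphericalSO4

end

/-! Each entry of `Φ` is a fixed linear functional of `τ(g)`: with `P` the isotypic projection,
`Φ(g)` is the compression of `P τ(g)` to `V(ℓ)`. A left invariant field `X` sends `R(τ(g) B)` to
`R(τ(g) τ̇(X) B)` for every continuous linear `R`, so `Δ₁` and `Δ₂` act on `Φ` by inserting the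
operators `casimir1 τ` and `casimir2 τ` to the right of `τ(g)`. If these are scalars, the scalars
are the eigenvalues.

They are scalars by Schur's lemma, once they commute with `τ(G)`. This is checked at the level of
the group, so connectedness of `SO(4)` plays no role. Both operators are combinations of two
manifest invariants: the full contraction of `τ̇(x ∧ y)²`, invariant under orthogonal maps, and the
antisymmetrization of `τ̇(x ∧ y) τ̇(z ∧ w)`, which conjugation by `g` multiplies by `det g = 1`. The
scalar is then read off on a highest weight vector by the `𝔰𝔩(2)` computation
`casimir_apply_highestWeightVector`.

The derived representation is defined only by derivatives along one-parameter groups. Its existence,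
linearity, equivariance and bracket relation come from three facts: a continuous one-parameter group
in a Banach algebra is an exponential, the Lie product formula, and differentiation of the adjoint
action. The exponential form also gives smoothness.

For sphericity, Schur orthogonality gives `χ * χ = χ` under convolution on `K`, hence `P² = P`,
hence `Φ(e) = I`. The functional equation is the identity `P τ(x) P τ(y) = ∫ χ(k⁻¹) P τ(x k y) dk`,
obtained by moving bounded linear maps through the integral that defines `P`. -/

open scoped Matrix ContDiff

noncomputable section

namespace SphericalSO4

/-! ### One-parameter groups and limits of powers in Banach algebras -/

section BanachAlgebra

/-- Telescoping. The sharp exponent would be `n - 1`; assuming `1 ≤ R` allows `R ^ n`, which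
suffices because the bound is used with `R = exp(c / n)`, where `R ^ n` does not depend on `n`. -/
theorem norm_pow_sub_pow_le {𝔸 : Type*} [NormedRing 𝔸] [NormOneClass 𝔸] {R : ℝ} (hR : 1 ≤ R) {x y : 𝔸} (hx : ‖x‖ ≤ R)
    (hy : ‖y‖ ≤ R) (n : ℕ) : ‖x ^ n - y ^ n‖ ≤ n * (R ^ n * ‖x - y‖) := by
  induction n with
  | zero => simp
  | succ n ih =>
    have hR0 : 0 ≤ R := zero_le_one.trans hR
    have h1 : x ^ (n + 1) - y ^ (n + 1) = x ^ n * (x - y) + (x ^ n - y ^ n) * y := by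
      rw [pow_succ, pow_succ]
      noncomm_ring
    have h2 : ‖x ^ n * (x - y)‖ ≤ R ^ (n + 1) * ‖x - y‖ :=
      (norm_mul_le _ _).trans (mul_le_mul_of_nonneg_right
        (((norm_pow_le x n).trans (pow_le_pow_left₀ (norm_nonneg _) hx n)).trans
          (pow_le_pow_right₀ hR n.le_succ)) (norm_nonneg _))
    have h3 : ‖(x ^ n - y ^ n) * y‖ ≤ n * (R ^ n * ‖x - y‖) * R :=
      (norm_mul_le _ _).trans (mul_le_mul ih hy (norm_nonneg _) (by positivity))
    rw [h1]
    refine (norm_add_le _ _).trans ((add_le_add h2 h3).trans_eq ?_)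
    push_cast
    ring

theorem eventually_norm_le_exp_of_hasDerivAt {𝔸 : Type*} [NormedRing 𝔸] [NormedAlgebra ℝ 𝔸]
    [NormOneClass 𝔸] {s : ℝ → 𝔸} {a : 𝔸} (hs0 : s 0 = 1)
    (hs : HasDerivAt s a 0) :
    ∀ᶠ h in nhds (0 : ℝ), ‖s h‖ ≤ Real.exp ((‖a‖ + 1) * |h|) := by
  have h1 := (hasDerivAt_iff_isLittleO.mp hs).def zero_lt_one
  filter_upwards [h1] with h hh
  simp only [hs0, sub_zero, one_mul, Real.norm_eq_abs] at hh
  have h2 : s h = (s h - 1 - h • a) + 1 + h • a := by abel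
  have h3 : ‖s h‖ ≤ |h| + 1 + |h| * ‖a‖ := by
    conv_lhs => rw [h2]
    refine (norm_add₃_le).trans (add_le_add (add_le_add hh norm_one.le) ?_)
    rw [norm_smul, Real.norm_eq_abs]
  refine h3.trans (le_trans (le_of_eq ?_) (Real.add_one_le_exp _))
  ring

variable {𝔸 : Type*} [NormedRing 𝔸] [NormedAlgebra ℝ 𝔸] [CompleteSpace 𝔸]

/-- A continuous one-parameter group in a Banach algebra is differentiable. -/
theorem differentiableAt_zero_of_continuous_of_add (u : ℝ → 𝔸) (hc : Continuous u) (h0 : u 0 = 1)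
    (hu : ∀ s t, u (s + t) = u s * u t) : DifferentiableAt ℝ u 0 := by
  -- Regularization by averaging: `F(a) / a → u 0 = 1` as `a → 0`, so `F(a) / a` is invertible for
  -- some `a ≠ 0`. Since `u(t) F(a) = F(t + a) - F(t)`, dividing expresses `u` through the
  -- differentiable function `F`.
  set F : ℝ → 𝔸 := fun a => ∫ s in (0 : ℝ)..a, u s with hF
  have hFd : ∀ a, HasDerivAt F (u a) a := fun a =>
    intervalIntegral.integral_hasDerivAt_right (hc.intervalIntegrable _ _)
      hc.aestronglyMeasurable.stronglyMeasurableAtFilter hc.continuousAt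
  have hsl := (hasDerivAt_iff_tendsto_slope.mp (hFd 0))
  rw [h0] at hsl
  have hunit := hsl.eventually (Units.isOpen.mem_nhds (isUnit_one (M := 𝔸)))
  obtain ⟨a, ha, ha0⟩ := (hunit.and self_mem_nhdsWithin).exists
  have ha0 : a ≠ 0 := ha0
  have hFa : slope F 0 a = a⁻¹ • F a := by
    simp [slope_def_module, hF]
  obtain ⟨w, hw⟩ := ha
  have hkey : ∀ t, u t = a⁻¹ • (F (t + a) - F t) * (↑w⁻¹ : 𝔸) := by
    intro t
    have h1 : u t * F a = F (t + a) - F t := by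
      have h2 : F (t + a) - F t = ∫ s in t..(t + a), u s :=
        intervalIntegral.integral_interval_sub_left (hc.intervalIntegrable _ _)
          (hc.intervalIntegrable _ _)
      rw [h2, hF]
      have h3 : ∫ s in (0 : ℝ)..a, u t * u s = u t * ∫ s in (0 : ℝ)..a, u s :=
        (ContinuousLinearMap.mul ℝ 𝔸 (u t)).intervalIntegral_comp_comm (hc.intervalIntegrable _ _)
      rw [← h3]
      simp_rw [← hu]
      rw [intervalIntegral.integral_comp_add_left (f := u)]
      simp
    rw [← h1, ← mul_smul_comm, ← hFa, ← hw, mul_assoc, Units.mul_inv, mul_one]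
  rw [funext hkey]
  have h5 : DifferentiableAt ℝ (fun t => F (t + a)) 0 :=
    ((hFd (0 + a)).comp_add_const 0 a).differentiableAt
  exact ((h5.sub (hFd 0).differentiableAt).const_smul a⁻¹).mul_const _

/-- A continuous one-parameter group in a Banach algebra is an exponential. -/
theorem eq_exp_smul_deriv_of_continuous_of_add (u : ℝ → 𝔸) (hc : Continuous u) (h0 : u 0 = 1)
    (hu : ∀ s t, u (s + t) = u s * u t) (t : ℝ) : u t = NormedSpace.exp (t • deriv u 0) := by
  let _ : NormedAlgebra ℚ 𝔸 := NormedAlgebra.restrictScalars ℚ ℝ 𝔸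
  set A := deriv u 0 with hA
  have hd0 := (differentiableAt_zero_of_continuous_of_add u hc h0 hu).hasDerivAt
  have hd : ∀ t, HasDerivAt u (u t * A) t := by
    intro t
    have h1 : HasDerivAt (fun s => u t * u (s - t)) (u t * A) t := by
      have h3 : HasDerivAt u A (t - t) := by rw [sub_self]; exact hd0
      exact (h3.comp_sub_const t t).const_mul (u t)
    refine h1.congr_of_eventuallyEq (Filter.Eventually.of_forall fun s => ?_)
    simp [← hu]
  have he : ∀ t : ℝ, HasDerivAt (fun s : ℝ => NormedSpace.exp (s • (-A)))
      (-A * NormedSpace.exp (t • (-A))) t := fun t => hasDerivAt_exp_smul_const' (-A) t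
  have hf : ∀ t, HasDerivAt (fun s => u s * NormedSpace.exp (s • (-A))) 0 t := by
    intro t
    have h := (hd t).mul (he t)
    rwa [show u t * A * NormedSpace.exp (t • (-A)) + u t * (-A * NormedSpace.exp (t • (-A))) = 0 by
      noncomm_ring] at h
  have hconst := is_const_of_deriv_eq_zero (fun t => (hf t).differentiableAt)
    (fun t => (hf t).deriv) t 0
  simp only [h0, zero_smul, NormedSpace.exp_zero, mul_one] at hconst
  have h6 : NormedSpace.exp (t • (-A)) * NormedSpace.exp (t • A) = 1 := by
    rw [← NormedSpace.exp_add_of_commute (by simp), smul_neg, neg_add_cancel, NormedSpace.exp_zero]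
  calc u t = u t * (NormedSpace.exp (t • (-A)) * NormedSpace.exp (t • A)) := by rw [h6, mul_one]
    _ = _ := by rw [← mul_assoc, hconst, one_mul]

/-- Powers of a curve through `1` converge to the exponential of its velocity. -/
theorem tendsto_pow_exp_of_hasDerivAt [NormOneClass 𝔸] {s : ℝ → 𝔸} {a : 𝔸} (hs0 : s 0 = 1)
    (hs : HasDerivAt s a 0) :
    Filter.Tendsto (fun n : ℕ => s (n : ℝ)⁻¹ ^ n) Filter.atTop (nhds (NormedSpace.exp a)) := by
  let _ : NormedAlgebra ℚ 𝔸 := NormedAlgebra.restrictScalars ℚ ℝ 𝔸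
  set t : ℝ → 𝔸 := fun h => NormedSpace.exp (h • a) with htdef
  have ht0 : t 0 = 1 := by simp [htdef]
  have ht : HasDerivAt t a 0 := by
    simpa [htdef] using hasDerivAt_exp_smul_const (𝕂 := ℝ) a (0 : ℝ)
  have hn0 : Filter.Tendsto (fun n : ℕ => (n : ℝ)⁻¹) Filter.atTop (nhds 0) :=
    tendsto_inv_atTop_nhds_zero_nat
  have hnne : Filter.Tendsto (fun n : ℕ => (n : ℝ)⁻¹) Filter.atTop (nhdsWithin 0 {0}ᶜ) := by
    refine tendsto_nhdsWithin_iff.mpr ⟨hn0, ?_⟩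
    filter_upwards [Filter.eventually_gt_atTop 0] with n hn
    simp [hn.ne']
  have hpow : ∀ᶠ n : ℕ in Filter.atTop, t (n : ℝ)⁻¹ ^ n = NormedSpace.exp a := by
    filter_upwards [Filter.eventually_gt_atTop 0] with n hn
    rw [htdef, ← NormedSpace.exp_nsmul, ← Nat.cast_smul_eq_nsmul ℝ, smul_smul,
      mul_inv_cancel₀ (by positivity), one_smul]
  -- Up to the norm, this is the difference quotient at `0` of `s - t`, whose derivative there is `a
  -- - a = 0`.
  have hd : Filter.Tendsto (fun n : ℕ => (n : ℝ) * ‖s (n : ℝ)⁻¹ - t (n : ℝ)⁻¹‖) Filter.atTop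
      (nhds 0) := by
    have h1 := ((hs.sub ht).tendsto_slope_zero.comp hnne).norm
    simp only [sub_self, norm_zero] at h1
    refine h1.congr fun n => ?_
    simp [hs0, ht0, norm_smul]
  rw [tendsto_iff_norm_sub_tendsto_zero]
  refine squeeze_zero' (Filter.Eventually.of_forall fun _ => norm_nonneg _) ?_
    (by simpa using hd.const_mul (Real.exp (‖a‖ + 1)))
  filter_upwards [hpow, hn0.eventually (eventually_norm_le_exp_of_hasDerivAt hs0 hs),
    hn0.eventually (eventually_norm_le_exp_of_hasDerivAt ht0 ht),
    Filter.eventually_gt_atTop 0] with n hn h1 h2 hpos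
  have h3 := norm_pow_sub_pow_le (Real.one_le_exp (by positivity)) h1 h2 n
  have hn' : (n : ℝ) ≠ 0 := by positivity
  rw [hn, ← Real.exp_nat_mul, abs_of_nonneg (by positivity : (0 : ℝ) ≤ (n : ℝ)⁻¹),
    show (n : ℝ) * ((‖a‖ + 1) * (n : ℝ)⁻¹) = ‖a‖ + 1 by field_simp] at h3
  refine h3.trans_eq ?_
  ring

end BanachAlgebra

/-! ### The derived representation of `𝔰𝔬(4)` -/

section DerivedRepresentation

open LieAlgebra.Orthogonal

theorem expSO4_zero : expSO4 0 = 1 := by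
  apply Subtype.ext
  simp [expSO4]

theorem expSO4_add_smul (X : so (Fin 4) ℝ) (s t : ℝ) :
    expSO4 ((s + t) • X) = expSO4 (s • X) * expSO4 (t • X) := by
  apply Subtype.ext
  have h : (((s + t) • X : so (Fin 4) ℝ) : Matrix (Fin 4) (Fin 4) ℝ) =
      ((s • X : so (Fin 4) ℝ) : Matrix (Fin 4) (Fin 4) ℝ) + ((t • X : so (Fin 4) ℝ) :
        Matrix (Fin 4) (Fin 4) ℝ) := by
    rw [add_smul]
    rfl
  change NormedSpace.exp (((s + t) • X : so (Fin 4) ℝ) : Matrix (Fin 4) (Fin 4) ℝ) = _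
  rw [h]
  refine Matrix.exp_add_of_commute _ _ ?_
  change Commute (s • (X : Matrix (Fin 4) (Fin 4) ℝ)) (t • (X : Matrix (Fin 4) (Fin 4) ℝ))
  exact ((Commute.refl _).smul_left s).smul_right t

section MatrixNorm

attribute [local instance] Matrix.linftyOpNormedRing Matrix.linftyOpNormedAlgebra

theorem hasDerivAt_matrix_exp_smul (M : Matrix (Fin 4) (Fin 4) ℝ) :
    HasDerivAt (fun t : ℝ => NormedSpace.exp (t • M)) M 0 := by
  have h := hasDerivAt_exp_smul_const (𝕂 := ℝ) M (0 : ℝ)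
  rw [zero_smul, NormedSpace.exp_zero, one_mul] at h
  exact h

theorem continuous_expSO4_smul (X : so (Fin 4) ℝ) : Continuous fun t : ℝ => expSO4 (t • X) := by
  refine Continuous.subtype_mk ?_ _
  change Continuous fun t : ℝ => NormedSpace.exp (t • (X : Matrix (Fin 4) (Fin 4) ℝ))
  exact continuous_iff_continuousAt.mpr fun t =>
    (hasDerivAt_exp_smul_const (𝕂 := ℝ) (X : Matrix (Fin 4) (Fin 4) ℝ) t).continuousAt

/-- The Lie product formula in `SO(4)`. -/
theorem tendsto_expSO4_mul_expSO4_pow (X Y : so (Fin 4) ℝ) :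
    Filter.Tendsto (fun n : ℕ => (expSO4 ((n : ℝ)⁻¹ • X) * expSO4 ((n : ℝ)⁻¹ • Y)) ^ n)
      Filter.atTop (nhds (expSO4 (X + Y))) := by
  rw [tendsto_subtype_rng]
  have h := (hasDerivAt_matrix_exp_smul (X : Matrix (Fin 4) (Fin 4) ℝ)).mul
    (hasDerivAt_matrix_exp_smul (Y : Matrix (Fin 4) (Fin 4) ℝ))
  have h2 := tendsto_pow_exp_of_hasDerivAt (by simp) h
  simp only [zero_smul, NormedSpace.exp_zero, mul_one, one_mul] at h2
  refine h2.congr fun n => ?_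
  rfl

/-- The curve `s ↦ exp(sN) M exp(-sN)` has velocity `[N, M]` at `0`. -/
theorem hasDerivAt_matrix_exp_conj (M N : Matrix (Fin 4) (Fin 4) ℝ) {F : Type*}
    [NormedAddCommGroup F] [NormedSpace ℝ F] (φ : Matrix (Fin 4) (Fin 4) ℝ →ₗ[ℝ] F) :
    HasDerivAt (fun s : ℝ => φ (NormedSpace.exp (s • N) * M * NormedSpace.exp (s • (-N))))
      (φ (N * M - M * N)) 0 := by
  have h := ((hasDerivAt_matrix_exp_smul N).mul_const M).mul (hasDerivAt_matrix_exp_smul (-N))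
  have h2 := (LinearMap.toContinuousLinearMap φ).hasFDerivAt.comp_hasDerivAt (0 : ℝ) h
  rw [zero_smul, zero_smul, NormedSpace.exp_zero, mul_one, one_mul, mul_neg,
    ← sub_eq_add_neg] at h2
  exact h2

end MatrixNorm

/-- The adjoint action of `SO(4)` on its Lie algebra. -/
def adjointAction (g : SO4) (X : so (Fin 4) ℝ) : so (Fin 4) ℝ :=
  ⟨(g : Matrix (Fin 4) (Fin 4) ℝ) * X * (g : Matrix (Fin 4) (Fin 4) ℝ)ᵀ, by
    have hX := (mem_so (Fin 4) ℝ _).mp X.2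
    rw [mem_so, Matrix.transpose_mul, Matrix.transpose_mul, Matrix.transpose_transpose, hX]
    simp [Matrix.mul_assoc]⟩

theorem mul_transpose_self (g : SO4) :
    (g : Matrix (Fin 4) (Fin 4) ℝ) * (g : Matrix (Fin 4) (Fin 4) ℝ)ᵀ = 1 :=
  (Matrix.mem_orthogonalGroup_iff _ _).mp (Matrix.mem_specialOrthogonalGroup_iff.mp g.2).1

theorem expSO4_adjointAction (g : SO4) (X : so (Fin 4) ℝ) :
    expSO4 (adjointAction g X) = g * expSO4 X * g⁻¹ := by
  apply Subtype.ext
  have hinv : (g : Matrix (Fin 4) (Fin 4) ℝ)⁻¹ = (g : Matrix (Fin 4) (Fin 4) ℝ)ᵀ :=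
    Matrix.inv_eq_right_inv (mul_transpose_self g)
  have hu : IsUnit (g : Matrix (Fin 4) (Fin 4) ℝ) :=
    ⟨⟨_, _, mul_transpose_self g, mul_eq_one_comm.mp (mul_transpose_self g)⟩, rfl⟩
  change NormedSpace.exp ((g : Matrix (Fin 4) (Fin 4) ℝ) * X * (g : Matrix (Fin 4) (Fin 4) ℝ)ᵀ) =
    (g : Matrix (Fin 4) (Fin 4) ℝ) * NormedSpace.exp (X : Matrix (Fin 4) (Fin 4) ℝ) *
      (g : Matrix (Fin 4) (Fin 4) ℝ)ᵀ
  rw [← hinv, Matrix.exp_conj _ _ hu]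

variable {V : Type*} [NormedAddCommGroup V] [NormedSpace ℂ V] [FiniteDimensional ℂ V]

theorem op_one {G : Type*} [Group G] (τ : Representation ℂ G V) : op τ 1 = 1 := by
  ext v
  simp [op]

theorem op_mul {G : Type*} [Group G] (τ : Representation ℂ G V) (g h : G) :
    op τ (g * h) = op τ g * op τ h := by
  ext v
  simp [op]

theorem op_pow {G : Type*} [Group G] (τ : Representation ℂ G V) (g : G) (n : ℕ) :
    op τ (g ^ n) = op τ g ^ n := by
  induction n with
  | zero => simp [op_one]
  | succ n ih => rw [pow_succ, pow_succ, op_mul, ih]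

variable {τ : Representation ℂ SO4 V}

theorem op_expSO4_smul (hτ : Continuous (op τ)) (X : so (Fin 4) ℝ) (t : ℝ) :
    op τ (expSO4 (t • X)) = NormedSpace.exp (t • derivRep τ X) := by
  have : CompleteSpace V := FiniteDimensional.complete ℂ V
  refine eq_exp_smul_deriv_of_continuous_of_add (fun t : ℝ => op τ (expSO4 (t • X)))
    (hτ.comp (continuous_expSO4_smul X)) ?_ (fun s t => ?_) t
  · simp [expSO4_zero, op_one]
  · simp only [expSO4_add_smul, op_mul]

theorem op_expSO4 (hτ : Continuous (op τ)) (X : so (Fin 4) ℝ) :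
    op τ (expSO4 X) = NormedSpace.exp (derivRep τ X) := by
  simpa using op_expSO4_smul hτ X 1

theorem hasDerivAt_op_expSO4_smul (hτ : Continuous (op τ)) (X : so (Fin 4) ℝ) :
    HasDerivAt (fun t : ℝ => op τ (expSO4 (t • X))) (derivRep τ X) 0 := by
  have : CompleteSpace V := FiniteDimensional.complete ℂ V
  simp_rw [op_expSO4_smul hτ]
  simpa using hasDerivAt_exp_smul_const (𝕂 := ℝ) (derivRep τ X) (0 : ℝ)

theorem derivRep_smul (hτ : Continuous (op τ)) (c : ℝ) (X : so (Fin 4) ℝ) :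
    derivRep τ (c • X) = c • derivRep τ X := by
  have h : HasDerivAt (fun t : ℝ => op τ (expSO4 (t • X))) (derivRep τ X) (0 * c) := by
    rw [zero_mul]
    exact hasDerivAt_op_expSO4_smul hτ X
  have h2 := h.scomp (0 : ℝ) ((hasDerivAt_id (0 : ℝ)).mul_const c)
  rw [one_mul] at h2
  have h3 := hasDerivAt_op_expSO4_smul hτ (c • X)
  simp_rw [smul_smul] at h3
  exact h3.unique h2

/-- Apply `τ` to the Lie product formula in `SO(4)` and compare with the same limit in `End V`; this
gives `τ(exp(X + Y)) = exp(τ̇(X) + τ̇(Y))`, which is then differentiated along `t(X + Y)`.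
Nontriviality of `V` gives `‖1‖ = 1` in `End V`, as the limit of powers requires. -/
theorem derivRep_add [Nontrivial V] (hτ : Continuous (op τ)) (X Y : so (Fin 4) ℝ) :
    derivRep τ (X + Y) = derivRep τ X + derivRep τ Y := by
  have : CompleteSpace V := FiniteDimensional.complete ℂ V
  have hexp : ∀ X Y : so (Fin 4) ℝ,
      op τ (expSO4 (X + Y)) = NormedSpace.exp (derivRep τ X + derivRep τ Y) := by
    intro X Y
    refine tendsto_nhds_unique
      ((hτ.tendsto _).comp (tendsto_expSO4_mul_expSO4_pow X Y)) ?_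
    refine (tendsto_pow_exp_of_hasDerivAt ?_
      ((hasDerivAt_op_expSO4_smul hτ X).mul (hasDerivAt_op_expSO4_smul hτ Y))).congr' ?_ |>.trans ?_
    · simp [expSO4_zero, op_one]
    · exact Filter.Eventually.of_forall fun n => by simp [op_pow, op_mul]
    · simp [expSO4_zero, op_one]
  have h1 := hasDerivAt_op_expSO4_smul hτ (X + Y)
  have h2 : ∀ t : ℝ, op τ (expSO4 (t • (X + Y))) =
      NormedSpace.exp (t • (derivRep τ X + derivRep τ Y)) := by
    intro t
    rw [smul_add, hexp, derivRep_smul hτ, derivRep_smul hτ, smul_add]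
  simp_rw [h2] at h1
  have h3 := hasDerivAt_exp_smul_const (𝕂 := ℝ) (derivRep τ X + derivRep τ Y) (0 : ℝ)
  simp only [zero_smul, NormedSpace.exp_zero, one_mul] at h3
  exact h1.unique h3

/-- The derived representation as a real linear map. -/
def derivRepLinear [Nontrivial V] (hτ : Continuous (op τ)) : so (Fin 4) ℝ →ₗ[ℝ] (V →L[ℂ] V) where
  toFun := derivRep τ
  map_add' := derivRep_add hτ
  map_smul' := derivRep_smul hτ

theorem op_mul_derivRep_mul_op_inv (hτ : Continuous (op τ)) (g : SO4) (X : so (Fin 4) ℝ) :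
    op τ g * derivRep τ X * op τ g⁻¹ = derivRep τ (adjointAction g X) := by
  have h1 := ((hasDerivAt_op_expSO4_smul hτ X).const_mul (op τ g)).mul_const (op τ g⁻¹)
  have h2 := hasDerivAt_op_expSO4_smul hτ (adjointAction g X)
  have h3 : ∀ t : ℝ, op τ (expSO4 (t • adjointAction g X)) =
      op τ g * op τ (expSO4 (t • X)) * op τ g⁻¹ := by
    intro t
    rw [← op_mul, ← op_mul, ← expSO4_adjointAction]
    congr 2
    apply Subtype.ext
    change t • ((g : Matrix (Fin 4) (Fin 4) ℝ) * X * (g : Matrix (Fin 4) (Fin 4) ℝ)ᵀ) =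
      (g : Matrix (Fin 4) (Fin 4) ℝ) * (t • (X : Matrix (Fin 4) (Fin 4) ℝ)) *
        (g : Matrix (Fin 4) (Fin 4) ℝ)ᵀ
    simp
  simp_rw [h3] at h2
  exact h1.unique h2

/-- The inclusion of `𝔰𝔬(4)` into the matrices, as a linear map. -/
def soVal : so (Fin 4) ℝ →ₗ[ℝ] Matrix (Fin 4) (Fin 4) ℝ where
  toFun X := X
  map_add' _ _ := rfl
  map_smul' _ _ := rfl

theorem soVal_skewUnit (i j : Fin 4) :
    soVal (skewUnit ℝ i j) = Matrix.single i j 1 - Matrix.single j i 1 := rfl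

/-- The factor `1/2` compensates for summing over ordered pairs. The coefficients are linear in the
entries of the matrix, which lets `τ̇` be extended to all matrices in `derivRep_lie`. -/
theorem eq_sum_skewUnit (X : so (Fin 4) ℝ) :
    X = ∑ i, ∑ j, ((1 / 2 : ℝ) * (X : Matrix (Fin 4) (Fin 4) ℝ) i j) • skewUnit ℝ i j := by
  have hX : ∀ i j, (X : Matrix (Fin 4) (Fin 4) ℝ) j i = -(X : Matrix (Fin 4) (Fin 4) ℝ) i j :=
    fun i j => congrFun (congrFun ((mem_so (Fin 4) ℝ _).mp X.2) i) j
  have hinj : Function.Injective soVal := Subtype.val_injective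
  apply hinj
  rw [show soVal X = (X : Matrix (Fin 4) (Fin 4) ℝ) from rfl]
  simp only [map_sum, map_smul]
  ext a b
  simp only [Matrix.sum_apply, Matrix.smul_apply]
  simp only [soVal_skewUnit, Matrix.sub_apply, Matrix.single_apply, smul_eq_mul, mul_sub,
    Finset.sum_sub_distrib]
  simp only [ite_and, mul_ite, mul_one, mul_zero, Finset.sum_ite_eq', Finset.mem_univ, if_true,
    Finset.sum_const_zero, Finset.sum_ite_irrel]
  rw [hX a b]
  ring

/-- Differentiate `τ̇(Ad(exp sY) X) = τ(exp sY) τ̇(X) τ(exp(-sY))` at `s = 0` in two ways. -/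
theorem derivRep_lie [Nontrivial V] (hτ : Continuous (op τ)) (X Y : so (Fin 4) ℝ) :
    derivRep τ ⁅Y, X⁆ = derivRep τ Y * derivRep τ X - derivRep τ X * derivRep τ Y := by
  -- A linear extension of `τ̇` from skew matrices to all matrices, so that the conjugation curve
  -- can be differentiated in the matrix space.
  let φ : Matrix (Fin 4) (Fin 4) ℝ →ₗ[ℝ] (V →L[ℂ] V) :=
    ∑ i, ∑ j, (Matrix.entryLinearMap ℝ ℝ i j).smulRight
      ((1 / 2 : ℝ) • derivRep τ (skewUnit ℝ i j))
  have hφ : ∀ Z : so (Fin 4) ℝ, φ (Z : Matrix (Fin 4) (Fin 4) ℝ) = derivRep τ Z := by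
    intro Z
    have h := congrArg (derivRepLinear hτ) (eq_sum_skewUnit Z)
    simp only [map_sum, map_smul] at h
    change derivRep τ Z = _ at h
    rw [h]
    simp only [φ, LinearMap.sum_apply, LinearMap.smulRight_apply, smul_smul,
      Matrix.entryLinearMap_apply]
    refine Finset.sum_congr rfl fun i _ => Finset.sum_congr rfl fun j _ => ?_
    rw [mul_comm]
    rfl
  have h1 := hasDerivAt_matrix_exp_conj X Y φ
  have h2 : ∀ s : ℝ, φ (NormedSpace.exp (s • (Y : Matrix (Fin 4) (Fin 4) ℝ)) * X *
      NormedSpace.exp (s • (-(Y : Matrix (Fin 4) (Fin 4) ℝ)))) =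
      op τ (expSO4 (s • Y)) * derivRep τ X * op τ (expSO4 (s • -Y)) := by
    intro s
    have hinv : expSO4 (s • -Y) = (expSO4 (s • Y))⁻¹ := by
      rw [eq_inv_iff_mul_eq_one, smul_neg, ← neg_smul, ← expSO4_add_smul]
      simp [expSO4_zero]
    rw [hinv, op_mul_derivRep_mul_op_inv hτ, ← hφ]
    congr 1
    have h3 : (((expSO4 (s • Y))⁻¹ : SO4) : Matrix (Fin 4) (Fin 4) ℝ) =
      NormedSpace.exp (s • (-(Y : Matrix (Fin 4) (Fin 4) ℝ))) := by
      rw [← hinv]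
      rfl
    rw [← h3]
    rfl
  simp_rw [h2] at h1
  have h4 := ((hasDerivAt_op_expSO4_smul hτ Y).mul_const (derivRep τ X)).mul
    (hasDerivAt_op_expSO4_smul hτ (-Y))
  have h5 : derivRep τ (-Y) = -derivRep τ Y := by
    rw [← neg_one_smul ℝ Y, derivRep_smul hτ, neg_one_smul]
  have h6 := h1.unique h4
  have h7 : φ ((Y : Matrix (Fin 4) (Fin 4) ℝ) * X - X * Y) = derivRep τ ⁅Y, X⁆ := hφ ⁅Y, X⁆
  rw [h7] at h6
  rw [h6, h5]
  simp [expSO4_zero, op_one, sub_eq_add_neg]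

/-- In these coordinates `τ` is the analytic map `exp` on `End V` composed with a linear map, by
linearity of `τ̇`. -/
theorem contDiff_op_expSO4 [Nontrivial V] (hτ : Continuous (op τ)) :
    ContDiff ℝ ∞ fun c : Fin 6 → ℝ => op τ (expSO4 (∑ i, c i • Y ℝ i)) := by
  have : CompleteSpace V := FiniteDimensional.complete ℂ V
  simp_rw [op_expSO4 hτ]
  have h : ∀ c : Fin 6 → ℝ, derivRep τ (∑ i, c i • Y ℝ i) = ∑ i, c i • derivRep τ (Y ℝ i) := by
    intro c
    have := map_sum (derivRepLinear hτ) (fun i => c i • Y ℝ i) Finset.univ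
    simp only [map_smul] at this
    exact this
  simp_rw [h]
  have he : ContDiff ℝ ∞ (NormedSpace.exp : (V →L[ℂ] V) → (V →L[ℂ] V)) :=
    contDiff_iff_contDiffAt.mpr fun x => (NormedSpace.exp_analytic (𝕂 := ℝ) x).contDiffAt
  exact he.comp (by fun_prop)

end DerivedRepresentation

open LieAlgebra.Orthogonal

/-! ### Schur's lemma -/

section Schur

theorem nontrivial_of_isIrreducible {V : Type*} [AddCommGroup V] [Module ℂ V]
    {G : Type*} [Group G] {τ : Representation ℂ G V}
    (hτ : τ.IsIrreducible) : Nontrivial V := by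
  by_contra h
  rw [not_nontrivial_iff_subsingleton] at h
  obtain ⟨a, b, hab⟩ := hτ.toNontrivial
  exact hab (Subrepresentation.toSubmodule_injective (Subsingleton.elim _ _))

variable {V : Type*} [NormedAddCommGroup V] [NormedSpace ℂ V] [FiniteDimensional ℂ V]

/-- Schur's lemma. -/
theorem exists_eq_smul_id_of_commute {G : Type*} [Group G] {τ : Representation ℂ G V}
    (hτ : τ.IsIrreducible) (T : V →ₗ[ℂ] V) (hT : ∀ g, T ∘ₗ τ g = τ g ∘ₗ T) :
    ∃ c : ℂ, T = c • LinearMap.id := by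
  let f : Representation.IntertwiningMap τ τ := ⟨T, hT⟩
  obtain ⟨c, hc⟩ :=
    (Representation.IsIrreducible.algebraMap_intertwiningMap_bijective_of_isAlgClosed
      (ρ := τ)).surjective f
  refine ⟨c, ?_⟩
  have h := congrArg Representation.IntertwiningMap.toLinearMap hc
  exact h.symm

end Schur

/-! ### Bivectors and orthogonal invariance of contractions -/

section Wedge

/-- The skew-symmetric matrix `x yᵀ - y xᵀ`, as a bilinear map. -/
def wedge : (Fin 4 → ℝ) →ₗ[ℝ] (Fin 4 → ℝ) →ₗ[ℝ] so (Fin 4) ℝ :=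
  LinearMap.mk₂ ℝ
    (fun x y => ⟨Matrix.vecMulVec x y - Matrix.vecMulVec y x, by
      rw [mem_so]
      simp [Matrix.transpose_sub, Matrix.transpose_vecMulVec]⟩)
    (fun x x' y => Subtype.ext (by
      change Matrix.vecMulVec _ _ - Matrix.vecMulVec _ _ =
        Matrix.vecMulVec _ _ - Matrix.vecMulVec _ _ + (Matrix.vecMulVec _ _ - Matrix.vecMulVec _ _)
      rw [Matrix.add_vecMulVec, Matrix.vecMulVec_add]
      abel))
    (fun c x y => Subtype.ext (by
      change Matrix.vecMulVec _ _ - Matrix.vecMulVec _ _ =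
        c • (Matrix.vecMulVec _ _ - Matrix.vecMulVec _ _)
      rw [Matrix.smul_vecMulVec, Matrix.vecMulVec_smul, smul_sub]))
    (fun x y y' => Subtype.ext (by
      change Matrix.vecMulVec _ _ - Matrix.vecMulVec _ _ =
        Matrix.vecMulVec _ _ - Matrix.vecMulVec _ _ + (Matrix.vecMulVec _ _ - Matrix.vecMulVec _ _)
      rw [Matrix.add_vecMulVec, Matrix.vecMulVec_add]
      abel))
    (fun c x y => Subtype.ext (by
      change Matrix.vecMulVec _ _ - Matrix.vecMulVec _ _ =
        c • (Matrix.vecMulVec _ _ - Matrix.vecMulVec _ _)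
      rw [Matrix.smul_vecMulVec, Matrix.vecMulVec_smul, smul_sub]))

theorem wedge_single (i j : Fin 4) :
    wedge (Pi.single i 1) (Pi.single j 1) = skewUnit ℝ i j := by
  apply Subtype.ext
  change Matrix.vecMulVec _ _ - Matrix.vecMulVec _ _ = Matrix.single i j 1 - Matrix.single j i 1
  rw [Matrix.single_eq_single_vecMulVec_single, Matrix.single_eq_single_vecMulVec_single]

theorem adjointAction_wedge (g : SO4) (x y : Fin 4 → ℝ) :
    adjointAction g (wedge x y) =
      wedge ((g : Matrix (Fin 4) (Fin 4) ℝ) *ᵥ x) ((g : Matrix (Fin 4) (Fin 4) ℝ) *ᵥ y) := by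
  apply Subtype.ext
  change (g : Matrix (Fin 4) (Fin 4) ℝ) * (Matrix.vecMulVec x y - Matrix.vecMulVec y x) *
    (g : Matrix (Fin 4) (Fin 4) ℝ)ᵀ = Matrix.vecMulVec _ _ - Matrix.vecMulVec _ _
  rw [mul_sub, sub_mul, Matrix.mul_vecMulVec, Matrix.mul_vecMulVec, Matrix.vecMulVec_mul,
    Matrix.vecMulVec_mul, Matrix.vecMul_transpose, Matrix.vecMul_transpose]

/-- The contraction of a bilinear map is invariant under orthogonal transformations. -/
theorem sum_apply_mulVec_single {E : Type*} [AddCommGroup E] [Module ℝ E] (g : SO4)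
    (b : (Fin 4 → ℝ) →ₗ[ℝ] (Fin 4 → ℝ) →ₗ[ℝ] E) :
    ∑ i, b ((g : Matrix (Fin 4) (Fin 4) ℝ) *ᵥ Pi.single i 1)
        ((g : Matrix (Fin 4) (Fin 4) ℝ) *ᵥ Pi.single i 1) =
      ∑ i, b (Pi.single i 1) (Pi.single i 1) := by
  have hg : ∀ i, (g : Matrix (Fin 4) (Fin 4) ℝ) *ᵥ Pi.single i 1 =
      ∑ a, (g : Matrix (Fin 4) (Fin 4) ℝ) a i • (Pi.single a 1 : Fin 4 → ℝ) := by
    intro i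
    rw [Matrix.mulVec_single_one]
    exact pi_eq_sum_univ' _
  -- Orthonormality of the rows of `g`; it collapses the double sum left by bilinearity to its
  -- diagonal.
  have hgg : ∀ a c, ∑ i, (g : Matrix (Fin 4) (Fin 4) ℝ) a i * (g : Matrix (Fin 4) (Fin 4) ℝ) c i =
      if a = c then 1 else 0 := by
    intro a c
    have h := congrFun (congrFun (mul_transpose_self g) a) c
    rwa [Matrix.mul_apply, Matrix.one_apply] at h
  simp only [hg, map_sum, map_smul, LinearMap.sum_apply, LinearMap.smul_apply, Finset.smul_sum,
    smul_smul]
  rw [Finset.sum_comm]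
  refine Finset.sum_congr rfl fun a _ => ?_
  rw [Finset.sum_comm]
  simp only [← Finset.sum_smul]
  simp [hgg]

end Wedge

/-- The 24 terms of a signed sum over `S₄`, produced by iterating the decomposition of a permutation
into the image of `0` and a permutation of the remaining points. It serves to expand
`pfaffianInvariant`. -/
theorem sum_sign_smul_perm_fin_four {E : Type*} [AddCommGroup E]
    (F : Fin 4 → Fin 4 → Fin 4 → Fin 4 → E) :
    ∑ σ : Equiv.Perm (Fin 4), Equiv.Perm.sign σ • F (σ 0) (σ 1) (σ 2) (σ 3) =
      F 0 1 2 3 - F 0 1 3 2 - F 0 2 1 3 + F 0 2 3 1 - F 0 3 2 1 + F 0 3 1 2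
      - F 1 0 2 3 + F 1 0 3 2 + F 1 2 0 3 - F 1 2 3 0 + F 1 3 2 0 - F 1 3 0 2
      - F 2 1 0 3 + F 2 1 3 0 + F 2 0 1 3 - F 2 0 3 1 + F 2 3 0 1 - F 2 3 1 0
      - F 3 1 2 0 + F 3 1 0 2 + F 3 2 1 0 - F 3 2 0 1 + F 3 0 2 1 - F 3 0 1 2 := by
  have e1 : ∀ (p : Fin 4) (e : Equiv.Perm (Fin 3)), Equiv.Perm.decomposeFin.symm (p, e) 1 =
      Equiv.swap 0 p (e 0).succ :=
    fun p e => Equiv.Perm.decomposeFin_symm_apply_succ e p 0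
  have e2 : ∀ (p : Fin 4) (e : Equiv.Perm (Fin 3)), Equiv.Perm.decomposeFin.symm (p, e) 2 =
      Equiv.swap 0 p (e 1).succ :=
    fun p e => Equiv.Perm.decomposeFin_symm_apply_succ e p 1
  have e3 : ∀ (p : Fin 4) (e : Equiv.Perm (Fin 3)), Equiv.Perm.decomposeFin.symm (p, e) 3 =
      Equiv.swap 0 p (e 2).succ :=
    fun p e => Equiv.Perm.decomposeFin_symm_apply_succ e p 2
  have e4 : ∀ (p : Fin 3) (e : Equiv.Perm (Fin 2)), Equiv.Perm.decomposeFin.symm (p, e) 1 =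
      Equiv.swap 0 p (e 0).succ :=
    fun p e => Equiv.Perm.decomposeFin_symm_apply_succ e p 0
  have e5 : ∀ (p : Fin 3) (e : Equiv.Perm (Fin 2)), Equiv.Perm.decomposeFin.symm (p, e) 2 =
      Equiv.swap 0 p (e 1).succ :=
    fun p e => Equiv.Perm.decomposeFin_symm_apply_succ e p 1
  have e6 : ∀ (p : Fin 2) (e : Equiv.Perm (Fin 1)), Equiv.Perm.decomposeFin.symm (p, e) 1 =
      Equiv.swap 0 p (e 0).succ :=
    fun p e => Equiv.Perm.decomposeFin_symm_apply_succ e p 0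
  rw [Finset.univ_perm_fin_succ, Finset.sum_map, ← Finset.univ_product_univ, Finset.sum_product]
  simp_rw [Finset.univ_perm_fin_succ (n := 2), Finset.sum_map,
    ← Finset.univ_product_univ, Finset.sum_product,
    Finset.univ_perm_fin_succ (n := 1), Finset.sum_map, ← Finset.univ_product_univ,
    Finset.sum_product]
  simp only [Equiv.toEmbedding_apply, Equiv.Perm.decomposeFin_symm_apply_zero,
    e1, e2, e3, e4, e5, e6, Equiv.Perm.decomposeFin.symm_sign,
    Finset.univ_unique, Finset.sum_singleton,
    Fin.sum_univ_four, Fin.sum_univ_three, Fin.sum_univ_two]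
  simp [Equiv.swap_apply_def, Fin.succ]
  abel

/-! ### The two quadratic invariants and the Casimir operators -/

section Invariants

variable {V : Type*} [NormedAddCommGroup V] [NormedSpace ℂ V] [FiniteDimensional ℂ V]
  {τ : Representation ℂ SO4 V}

/-- Conjugation by `τ(g)`. -/
def opConj (τ : Representation ℂ SO4 V) (g : SO4) : (V →L[ℂ] V) →ₗ[ℝ] (V →L[ℂ] V) where
  toFun T := op τ g * T * op τ g⁻¹
  map_add' := by simp [mul_add, add_mul]
  map_smul' := by simp

theorem opConj_mul (g : SO4) (S T : V →L[ℂ] V) :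
    opConj τ g (S * T) = opConj τ g S * opConj τ g T := by
  have h : op τ g⁻¹ * op τ g = 1 := by rw [← op_mul, inv_mul_cancel, op_one]
  calc op τ g * (S * T) * op τ g⁻¹ = op τ g * S * 1 * T * op τ g⁻¹ := by simp [mul_assoc]
    _ = _ := by
      rw [← h]
      simp only [opConj, LinearMap.coe_mk, AddHom.coe_mk, mul_assoc]

theorem derivRep_skewUnit_swap (hτ : Continuous (op τ)) (i j : Fin 4) :
    derivRep τ (skewUnit ℝ j i) = -derivRep τ (skewUnit ℝ i j) := by
  have h : skewUnit ℝ j i = (-1 : ℝ) • skewUnit ℝ i j := by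
    apply Subtype.ext
    change _ = (-1 : ℝ) • (Matrix.single i j 1 - Matrix.single j i 1)
    rw [neg_one_smul, neg_sub]
    rfl
  rw [h, derivRep_smul hτ, neg_one_smul]

theorem derivRep_skewUnit_self (hτ : Continuous (op τ)) (i : Fin 4) :
    derivRep τ (skewUnit ℝ i i) = 0 := by
  have h : skewUnit ℝ i i = (0 : ℝ) • skewUnit ℝ i i := by
    apply Subtype.ext
    change Matrix.single i i 1 - Matrix.single i i 1 = (0 : ℝ) • _
    rw [zero_smul, sub_self]
  rw [h, derivRep_smul hτ, zero_smul]

/-- An operator commuting with an irreducible representation acts by its eigenvalue. -/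
theorem eq_smul_one_of_opConj_eq (hτ : τ.IsIrreducible) {T : V →L[ℂ] V}
    (hT : ∀ g, opConj τ g T = T) {v : V} (hv : v ≠ 0) {c : ℂ} (hc : T v = c • v) : T = c • 1 := by
  have hcomm : ∀ g, (T : V →ₗ[ℂ] V) ∘ₗ τ g = τ g ∘ₗ (T : V →ₗ[ℂ] V) := by
    intro g
    have h1 : op τ g⁻¹ * op τ g = 1 := by rw [← op_mul, inv_mul_cancel, op_one]
    have h2 : T * op τ g = op τ g * T := by
      conv_lhs => rw [← hT g]
      change op τ g * T * op τ g⁻¹ * op τ g = _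
      rw [mul_assoc, h1, mul_one]
    ext w
    exact congrArg (fun S : V →L[ℂ] V => S w) h2
  obtain ⟨d, hd⟩ := exists_eq_smul_id_of_commute hτ (T : V →ₗ[ℂ] V) hcomm
  have hTd : T = d • 1 := by
    ext w
    exact congrArg (fun S : V →ₗ[ℂ] V => S w) hd
  have h3 : d • v = c • v := by
    rw [← hc, hTd]
    rfl
  rw [hTd, smul_left_injective ℂ hv h3]

variable [Nontrivial V]

/-- The bilinear map `(x, y) ↦ τ̇(x yᵀ - y xᵀ)`. -/
def derivRepWedge (hτ : Continuous (op τ)) :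
    (Fin 4 → ℝ) →ₗ[ℝ] (Fin 4 → ℝ) →ₗ[ℝ] (V →L[ℂ] V) :=
  wedge.compr₂ (derivRepLinear hτ)

theorem derivRepWedge_single (hτ : Continuous (op τ)) (i j : Fin 4) :
    derivRepWedge hτ (Pi.single i 1) (Pi.single j 1) = derivRep τ (skewUnit ℝ i j) := by
  rw [← wedge_single]
  rfl

theorem opConj_derivRepWedge (hτ : Continuous (op τ)) (g : SO4) (x y : Fin 4 → ℝ) :
    opConj τ g (derivRepWedge hτ x y) =
      derivRepWedge hτ ((g : Matrix (Fin 4) (Fin 4) ℝ) *ᵥ x)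
        ((g : Matrix (Fin 4) (Fin 4) ℝ) *ᵥ y) := by
  change op τ g * derivRep τ (wedge x y) * op τ g⁻¹ = derivRep τ (wedge _ _)
  rw [op_mul_derivRep_mul_op_inv hτ, adjointAction_wedge]

/-- The sum of the squares of the operators `τ̇(E_{ij} - E_{ji})`. -/
def quadraticInvariant (hτ : Continuous (op τ)) : V →L[ℂ] V :=
  ∑ i, ∑ j, derivRepWedge hτ (Pi.single i 1) (Pi.single j 1) *
    derivRepWedge hτ (Pi.single i 1) (Pi.single j 1)

/-- Conjugation replaces each basis vector `e_i` by `g e_i`; invariance of contractions is then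
applied to one index at a time, the other being held fixed. -/
theorem opConj_quadraticInvariant (hτ : Continuous (op τ)) (g : SO4) :
    opConj τ g (quadraticInvariant hτ) = quadraticInvariant hτ := by
  let β := derivRepWedge hτ
  have h1 : ∀ x, ∑ j, β x ((g : Matrix (Fin 4) (Fin 4) ℝ) *ᵥ Pi.single j 1) *
      β x ((g : Matrix (Fin 4) (Fin 4) ℝ) *ᵥ Pi.single j 1) =
      ∑ j, β x (Pi.single j 1) * β x (Pi.single j 1) := fun x =>
    sum_apply_mulVec_single g ((LinearMap.mul ℝ (V →L[ℂ] V)).compl₁₂ (β x) (β x))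
  have h2 : ∀ y, ∑ i, β ((g : Matrix (Fin 4) (Fin 4) ℝ) *ᵥ Pi.single i 1) y *
      β ((g : Matrix (Fin 4) (Fin 4) ℝ) *ᵥ Pi.single i 1) y =
      ∑ i, β (Pi.single i 1) y * β (Pi.single i 1) y := fun y =>
    sum_apply_mulVec_single g ((LinearMap.mul ℝ (V →L[ℂ] V)).compl₁₂ (β.flip y) (β.flip y))
  simp only [quadraticInvariant, map_sum, opConj_mul, opConj_derivRepWedge]
  simp only [β] at h1 h2
  simp only [h1]
  rw [Finset.sum_comm]
  simp only [h2]
  rw [Finset.sum_comm]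

/-- The multilinear map `(x, y, z, w) ↦ τ̇(x yᵀ - y xᵀ) τ̇(z wᵀ - w zᵀ)`. -/
def wedgeProduct (hτ : Continuous (op τ)) :
    MultilinearMap ℝ (fun _ : Fin 4 => Fin 4 → ℝ) (V →L[ℂ] V) :=
  MultilinearMap.mk' (fun v => derivRepWedge hτ (v 0) (v 1) * derivRepWedge hτ (v 2) (v 3))
    (by
      intro v i x y
      fin_cases i <;> simp [add_mul, mul_add])
    (by
      intro v i c x
      fin_cases i <;> simp)

/-- The antisymmetrization of the products `τ̇(E_{ij} - E_{ji}) τ̇(E_{kl} - E_{lk})`. -/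
def pfaffianInvariant (hτ : Continuous (op τ)) : V →L[ℂ] V :=
  MultilinearMap.alternatization (wedgeProduct hτ) fun i => Pi.single i 1

theorem opConj_pfaffianInvariant (hτ : Continuous (op τ)) (g : SO4) :
    opConj τ g (pfaffianInvariant hτ) = pfaffianInvariant hτ := by
  set f := MultilinearMap.alternatization (wedgeProduct hτ) with hf
  have h1 : opConj τ g (pfaffianInvariant hτ) =
      f fun i => (g : Matrix (Fin 4) (Fin 4) ℝ) *ᵥ Pi.single i 1 := by
    rw [pfaffianInvariant, hf, MultilinearMap.alternatization_apply,
      MultilinearMap.alternatization_apply, map_sum]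
    refine Finset.sum_congr rfl fun σ _ => ?_
    have hs : ∀ T, opConj τ g (Equiv.Perm.sign σ • T) = Equiv.Perm.sign σ • opConj τ g T := by
      intro T
      rcases Int.units_eq_one_or (Equiv.Perm.sign σ) with h | h <;> simp [h]
    rw [hs]
    congr 1
    change opConj τ g (_ * _) = _ * _
    rw [opConj_mul, opConj_derivRepWedge, opConj_derivRepWedge]
  -- An alternating 4-form on `ℝ⁴` is its value on the standard basis times the determinant. Hence
  -- replacing `e_i` by `g e_i` multiplies the value by `det g`, and this is where `det g = 1`
  -- enters.
  have h2 : f = (LinearMap.toSpanSingleton ℝ (V →L[ℂ] V)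
      (f (Pi.basisFun ℝ (Fin 4)))).compAlternatingMap (Pi.basisFun ℝ (Fin 4)).det := by
    refine Module.Basis.ext_alternating (Pi.basisFun ℝ (Fin 4)) fun i h => ?_
    let σ : Equiv.Perm (Fin 4) := Equiv.ofBijective i (Finite.injective_iff_bijective.1 h)
    change f (Pi.basisFun ℝ (Fin 4) ∘ σ) = LinearMap.compAlternatingMap _ _
      (Pi.basisFun ℝ (Fin 4) ∘ σ)
    rw [AlternatingMap.map_perm, AlternatingMap.map_perm, LinearMap.compAlternatingMap_apply,
      Module.Basis.det_self, LinearMap.toSpanSingleton_apply, one_smul]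
  have h3 : (Pi.basisFun ℝ (Fin 4)).det
      (fun i => (g : Matrix (Fin 4) (Fin 4) ℝ) *ᵥ Pi.single i 1) = 1 := by
    rw [Pi.basisFun_det_apply]
    refine Eq.trans ?_ ((Matrix.det_transpose _).trans
      (Matrix.mem_specialOrthogonalGroup_iff.mp g.2).2)
    congr 1
    ext i j
    rw [Matrix.transpose_apply, Matrix.of_apply, Matrix.mulVec_single_one]
    rfl
  have h4 : (Pi.basisFun ℝ (Fin 4) : Fin 4 → Fin 4 → ℝ) = fun i => Pi.single i 1 := by
    ext i
    simp
  rw [h1, h2, LinearMap.compAlternatingMap_apply, h3, LinearMap.toSpanSingleton_apply, one_smul, h4]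
  rfl

theorem quadraticInvariant_eq (hτ : Continuous (op τ)) {B : Fin 4 → Fin 4 → V →L[ℂ] V}
    (hB : B = fun i j => derivRep τ (skewUnit ℝ i j)) :
    quadraticInvariant hτ = (2 : ℝ) • (B 0 1 * B 0 1 + B 0 2 * B 0 2 + B 0 3 * B 0 3 +
      B 1 2 * B 1 2 + B 1 3 * B 1 3 + B 2 3 * B 2 3) := by
  simp only [quadraticInvariant, derivRepWedge_single, Fin.sum_univ_four,
    derivRep_skewUnit_self hτ, derivRep_skewUnit_swap hτ 0 1, derivRep_skewUnit_swap hτ 0 2,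
    derivRep_skewUnit_swap hτ 0 3, derivRep_skewUnit_swap hτ 1 2, derivRep_skewUnit_swap hτ 1 3,
    derivRep_skewUnit_swap hτ 2 3, neg_mul_neg, mul_zero, hB]
  module

/-- The factor `4` comes from exchanging the two indices inside each factor: the sign of the
permutation cancels that of `B j i = -B i j`. The two orders of each product are kept apart, so no
commutation is needed. -/
theorem pfaffianInvariant_eq (hτ : Continuous (op τ)) {B : Fin 4 → Fin 4 → V →L[ℂ] V}
    (hB : B = fun i j => derivRep τ (skewUnit ℝ i j)) :
    pfaffianInvariant hτ = (4 : ℝ) • (B 0 1 * B 2 3 + B 2 3 * B 0 1 - B 0 2 * B 1 3 -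
      B 1 3 * B 0 2 + B 0 3 * B 1 2 + B 1 2 * B 0 3) := by
  have h : ∀ σ : Equiv.Perm (Fin 4), (wedgeProduct hτ).domDomCongr σ (fun i => Pi.single i 1) =
      B (σ 0) (σ 1) * B (σ 2) (σ 3) := by
    intro σ
    rw [hB]
    simp only [← derivRepWedge_single hτ]
    rfl
  rw [pfaffianInvariant, MultilinearMap.alternatization_apply]
  simp only [h]
  rw [sum_sign_smul_perm_fin_four fun i j k l => B i j * B k l]
  simp only [hB, derivRep_skewUnit_swap hτ 0 1, derivRep_skewUnit_swap hτ 0 2,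
    derivRep_skewUnit_swap hτ 0 3, derivRep_skewUnit_swap hτ 1 2, derivRep_skewUnit_swap hτ 1 3,
    derivRep_skewUnit_swap hτ 2 3, neg_mul, mul_neg]
  module

/-- The image of the Casimir operator `Δ₁` under the derived representation. -/
def casimir1 (τ : Representation ℂ SO4 V) : V →L[ℂ] V :=
  -(derivRep τ Z4 * derivRep τ Z4) - derivRep τ Z5 * derivRep τ Z5 - derivRep τ Z6 * derivRep τ Z6

/-- The image of the Casimir operator `Δ₂` under the derived representation. -/
def casimir2 (τ : Representation ℂ SO4 V) : V →L[ℂ] V :=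
  -(derivRep τ Z1 * derivRep τ Z1) - derivRep τ Z2 * derivRep τ Z2 - derivRep τ Z3 * derivRep τ Z3

theorem derivRep_half_add (hτ : Continuous (op τ)) (X X' : so (Fin 4) ℝ) :
    derivRep τ ((1 / 2 : ℝ) • (X + X')) = (1 / 2 : ℝ) • (derivRep τ X + derivRep τ X') := by
  rw [derivRep_smul hτ, derivRep_add hτ]

theorem derivRep_half_sub (hτ : Continuous (op τ)) (X X' : so (Fin 4) ℝ) :
    derivRep τ ((1 / 2 : ℝ) • (X - X')) = (1 / 2 : ℝ) • (derivRep τ X - derivRep τ X') := by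
  have h := map_sub (derivRepLinear hτ) X X'
  rw [derivRep_smul hτ]
  exact congrArg _ h

/-- Expanding the squares of the half sums and half differences, the squares of the `Y_i` give the
quadratic invariant and the cross terms give the Pfaffian one. For `casimir2` the cross terms change
sign. -/
theorem casimir1_eq (hτ : Continuous (op τ)) :
    casimir1 τ = -(1 / 8 : ℝ) • quadraticInvariant hτ + (1 / 16 : ℝ) • pfaffianInvariant hτ := by
  rw [quadraticInvariant_eq hτ rfl, pfaffianInvariant_eq hτ rfl]
  simp only [casimir1, Z4, Z5, Z6, derivRep_half_add hτ, derivRep_half_sub hτ, Y,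
    Matrix.cons_val, smul_mul_smul, mul_add, add_mul, mul_sub, sub_mul]
  module

theorem casimir2_eq (hτ : Continuous (op τ)) :
    casimir2 τ = -(1 / 8 : ℝ) • quadraticInvariant hτ - (1 / 16 : ℝ) • pfaffianInvariant hτ := by
  rw [quadraticInvariant_eq hτ rfl, pfaffianInvariant_eq hτ rfl]
  simp only [casimir2, Z1, Z2, Z3, derivRep_half_add hτ, derivRep_half_sub hτ, Y,
    Matrix.cons_val, smul_mul_smul, mul_add, add_mul, mul_sub, sub_mul]
  module

theorem opConj_casimir1 (hτ : Continuous (op τ)) (g : SO4) :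
    opConj τ g (casimir1 τ) = casimir1 τ := by
  rw [casimir1_eq hτ, map_add, map_smul, map_smul, opConj_quadraticInvariant,
    opConj_pfaffianInvariant]

theorem opConj_casimir2 (hτ : Continuous (op τ)) (g : SO4) :
    opConj τ g (casimir2 τ) = casimir2 τ := by
  rw [casimir2_eq hτ, map_sub, map_smul, map_smul, opConj_quadraticInvariant,
    opConj_pfaffianInvariant]

end Invariants

/-! ### Root vectors and the eigenvalues on a highest weight vector -/

section HighestWeight

/-- The element `Z₄ + i Z₅`, a root vector of the root `ε₁ - ε₂`. -/
def rootVector1 : so (Fin 4) ℂ :=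
  (1 / 2 : ℂ) • (Y ℂ 2 - Y ℂ 3) + (Complex.I / 2) • (Y ℂ 1 + Y ℂ 4)

/-- The element `Z₁ + i Z₂`, a root vector of the root `ε₁ + ε₂`. -/
def rootVector2 : so (Fin 4) ℂ :=
  (1 / 2 : ℂ) • (Y ℂ 2 + Y ℂ 3) + (Complex.I / 2) • (Y ℂ 1 - Y ℂ 4)

theorem coe_Y (R : Type) [CommRing R] :
    (Y R 0 : Matrix (Fin 4) (Fin 4) R) = !![0, 1, 0, 0; -1, 0, 0, 0; 0, 0, 0, 0; 0, 0, 0, 0] ∧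
    (Y R 1 : Matrix (Fin 4) (Fin 4) R) = !![0, 0, 1, 0; 0, 0, 0, 0; -1, 0, 0, 0; 0, 0, 0, 0] ∧
    (Y R 2 : Matrix (Fin 4) (Fin 4) R) = !![0, 0, 0, 0; 0, 0, 1, 0; 0, -1, 0, 0; 0, 0, 0, 0] ∧
    (Y R 3 : Matrix (Fin 4) (Fin 4) R) = !![0, 0, 0, 1; 0, 0, 0, 0; 0, 0, 0, 0; -1, 0, 0, 0] ∧
    (Y R 4 : Matrix (Fin 4) (Fin 4) R) = !![0, 0, 0, 0; 0, 0, 0, 1; 0, 0, 0, 0; 0, -1, 0, 0] ∧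
    (Y R 5 : Matrix (Fin 4) (Fin 4) R) = !![0, 0, 0, 0; 0, 0, 0, 0; 0, 0, 0, 1; 0, 0, -1, 0] := by
  refine ⟨?_, ?_, ?_, ?_, ?_, ?_⟩ <;>
  · ext i j
    change (Matrix.single _ _ 1 - Matrix.single _ _ 1 : Matrix (Fin 4) (Fin 4) R) i j = _
    fin_cases i <;> fin_cases j <;> simp

theorem coe_rootVector1 : (rootVector1 : Matrix (Fin 4) (Fin 4) ℂ) =
    !![0, 0, Complex.I / 2, -1 / 2; 0, 0, 1 / 2, Complex.I / 2;
      -Complex.I / 2, -1 / 2, 0, 0; 1 / 2, -Complex.I / 2, 0, 0] := by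
  change (1 / 2 : ℂ) • ((Y ℂ 2 : Matrix (Fin 4) (Fin 4) ℂ) - (Y ℂ 3 : Matrix (Fin 4) (Fin 4) ℂ)) +
    (Complex.I / 2) • ((Y ℂ 1 : Matrix (Fin 4) (Fin 4) ℂ) + (Y ℂ 4 : Matrix (Fin 4) (Fin 4) ℂ)) = _
  obtain ⟨h0, h1, h2, h3, h4, h5⟩ := coe_Y ℂ
  rw [h1, h2, h3, h4]
  ext i j
  fin_cases i <;> fin_cases j <;> simp <;> ring

theorem coe_rootVector2 : (rootVector2 : Matrix (Fin 4) (Fin 4) ℂ) =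
    !![0, 0, Complex.I / 2, 1 / 2; 0, 0, 1 / 2, -Complex.I / 2;
      -Complex.I / 2, -1 / 2, 0, 0; -1 / 2, Complex.I / 2, 0, 0] := by
  change (1 / 2 : ℂ) • ((Y ℂ 2 : Matrix (Fin 4) (Fin 4) ℂ) + (Y ℂ 3 : Matrix (Fin 4) (Fin 4) ℂ)) +
    (Complex.I / 2) • ((Y ℂ 1 : Matrix (Fin 4) (Fin 4) ℂ) - (Y ℂ 4 : Matrix (Fin 4) (Fin 4) ℂ)) = _
  obtain ⟨h0, h1, h2, h3, h4, h5⟩ := coe_Y ℂ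
  rw [h1, h2, h3, h4]
  ext i j
  fin_cases i <;> fin_cases j <;> simp <;> ring

theorem coe_cartan (x₁ x₂ : ℂ) : (cartan x₁ x₂ : Matrix (Fin 4) (Fin 4) ℂ) =
    !![0, x₁, 0, 0; -x₁, 0, 0, 0; 0, 0, 0, x₂; 0, 0, -x₂, 0] := by
  change x₁ • (Y ℂ 0 : Matrix (Fin 4) (Fin 4) ℂ) + x₂ • (Y ℂ 5 : Matrix (Fin 4) (Fin 4) ℂ) = _
  obtain ⟨h0, h1, h2, h3, h4, h5⟩ := coe_Y ℂ
  rw [h0, h5]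
  ext i j
  fin_cases i <;> fin_cases j <;> simp

theorem inRootSpace_rootVector1 : InRootSpace 1 (-1) rootVector1 := by
  intro x₁ x₂
  apply Subtype.ext
  change (cartan x₁ x₂ : Matrix (Fin 4) (Fin 4) ℂ) * rootVector1 - rootVector1 * cartan x₁ x₂ =
    weight 1 (-1) x₁ x₂ • (rootVector1 : Matrix (Fin 4) (Fin 4) ℂ)
  rw [coe_cartan, coe_rootVector1]
  ext i j
  fin_cases i <;> fin_cases j <;>
    simp [weight] <;> ring_nf <;> simp <;> ring

theorem inRootSpace_rootVector2 : InRootSpace 1 1 rootVector2 := by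
  intro x₁ x₂
  apply Subtype.ext
  change (cartan x₁ x₂ : Matrix (Fin 4) (Fin 4) ℂ) * rootVector2 - rootVector2 * cartan x₁ x₂ =
    weight 1 1 x₁ x₂ • (rootVector2 : Matrix (Fin 4) (Fin 4) ℂ)
  rw [coe_cartan, coe_rootVector2]
  ext i j
  fin_cases i <;> fin_cases j <;>
    simp [weight] <;> ring_nf <;> simp <;> ring

theorem coe_Z1 : (Z1 : Matrix (Fin 4) (Fin 4) ℝ) =
    !![0, 0, 0, 1 / 2; 0, 0, 1 / 2, 0; 0, -1 / 2, 0, 0; -1 / 2, 0, 0, 0] := by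
  change (1 / 2 : ℝ) • ((Y ℝ 2 : Matrix (Fin 4) (Fin 4) ℝ) + (Y ℝ 3 : Matrix (Fin 4) (Fin 4) ℝ)) = _
  obtain ⟨h0, h1, h2, h3, h4, h5⟩ := coe_Y ℝ
  rw [h2, h3]
  ext i j
  fin_cases i <;> fin_cases j <;> simp <;> ring

theorem coe_Z2 : (Z2 : Matrix (Fin 4) (Fin 4) ℝ) =
    !![0, 0, 1 / 2, 0; 0, 0, 0, -1 / 2; -1 / 2, 0, 0, 0; 0, 1 / 2, 0, 0] := by
  change (1 / 2 : ℝ) • ((Y ℝ 1 : Matrix (Fin 4) (Fin 4) ℝ) - (Y ℝ 4 : Matrix (Fin 4) (Fin 4) ℝ)) = _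
  obtain ⟨h0, h1, h2, h3, h4, h5⟩ := coe_Y ℝ
  rw [h1, h4]
  ext i j
  fin_cases i <;> fin_cases j <;> simp <;> ring

theorem coe_Z3 : (Z3 : Matrix (Fin 4) (Fin 4) ℝ) =
    !![0, 1 / 2, 0, 0; -1 / 2, 0, 0, 0; 0, 0, 0, 1 / 2; 0, 0, -1 / 2, 0] := by
  change (1 / 2 : ℝ) • ((Y ℝ 0 : Matrix (Fin 4) (Fin 4) ℝ) + (Y ℝ 5 : Matrix (Fin 4) (Fin 4) ℝ)) = _
  obtain ⟨h0, h1, h2, h3, h4, h5⟩ := coe_Y ℝ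
  rw [h0, h5]
  ext i j
  fin_cases i <;> fin_cases j <;> simp <;> ring

theorem coe_Z4 : (Z4 : Matrix (Fin 4) (Fin 4) ℝ) =
    !![0, 0, 0, -1 / 2; 0, 0, 1 / 2, 0; 0, -1 / 2, 0, 0; 1 / 2, 0, 0, 0] := by
  change (1 / 2 : ℝ) • ((Y ℝ 2 : Matrix (Fin 4) (Fin 4) ℝ) - (Y ℝ 3 : Matrix (Fin 4) (Fin 4) ℝ)) = _
  obtain ⟨h0, h1, h2, h3, h4, h5⟩ := coe_Y ℝ
  rw [h2, h3]
  ext i j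
  fin_cases i <;> fin_cases j <;> simp <;> ring

theorem coe_Z5 : (Z5 : Matrix (Fin 4) (Fin 4) ℝ) =
    !![0, 0, 1 / 2, 0; 0, 0, 0, 1 / 2; -1 / 2, 0, 0, 0; 0, -1 / 2, 0, 0] := by
  change (1 / 2 : ℝ) • ((Y ℝ 1 : Matrix (Fin 4) (Fin 4) ℝ) + (Y ℝ 4 : Matrix (Fin 4) (Fin 4) ℝ)) = _
  obtain ⟨h0, h1, h2, h3, h4, h5⟩ := coe_Y ℝ
  rw [h1, h4]
  ext i j
  fin_cases i <;> fin_cases j <;> simp <;> ring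

theorem coe_Z6 : (Z6 : Matrix (Fin 4) (Fin 4) ℝ) =
    !![0, 1 / 2, 0, 0; -1 / 2, 0, 0, 0; 0, 0, 0, -1 / 2; 0, 0, 1 / 2, 0] := by
  change (1 / 2 : ℝ) • ((Y ℝ 0 : Matrix (Fin 4) (Fin 4) ℝ) - (Y ℝ 5 : Matrix (Fin 4) (Fin 4) ℝ)) = _
  obtain ⟨h0, h1, h2, h3, h4, h5⟩ := coe_Y ℝ
  rw [h0, h5]
  ext i j
  fin_cases i <;> fin_cases j <;> simp <;> ring

theorem lie_Z1_Z2 : ⁅Z1, Z2⁆ = Z3 := by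
  apply Subtype.ext
  change (Z1 : Matrix (Fin 4) (Fin 4) ℝ) * Z2 - Z2 * Z1 = Z3
  rw [coe_Z1, coe_Z2, coe_Z3]
  ext i j
  fin_cases i <;> fin_cases j <;> simp <;> norm_num

theorem lie_Z4_Z5 : ⁅Z4, Z5⁆ = Z6 := by
  apply Subtype.ext
  change (Z4 : Matrix (Fin 4) (Fin 4) ℝ) * Z5 - Z5 * Z4 = Z6
  rw [coe_Z4, coe_Z5, coe_Z6]
  ext i j
  fin_cases i <;> fin_cases j <;> simp <;> norm_num

theorem rePart_rootVector1 : rePart rootVector1 = Z4 := by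
  apply Subtype.ext
  change (rootVector1 : Matrix (Fin 4) (Fin 4) ℂ).map Complex.re = Z4
  rw [coe_rootVector1, coe_Z4]
  ext i j
  fin_cases i <;> fin_cases j <;> simp

theorem imPart_rootVector1 : imPart rootVector1 = Z5 := by
  apply Subtype.ext
  change (rootVector1 : Matrix (Fin 4) (Fin 4) ℂ).map Complex.im = Z5
  rw [coe_rootVector1, coe_Z5]
  ext i j
  fin_cases i <;> fin_cases j <;> simp

theorem rePart_rootVector2 : rePart rootVector2 = Z1 := by
  apply Subtype.ext
  change (rootVector2 : Matrix (Fin 4) (Fin 4) ℂ).map Complex.re = Z1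
  rw [coe_rootVector2, coe_Z1]
  ext i j
  fin_cases i <;> fin_cases j <;> simp

theorem imPart_rootVector2 : imPart rootVector2 = Z2 := by
  apply Subtype.ext
  change (rootVector2 : Matrix (Fin 4) (Fin 4) ℂ).map Complex.im = Z2
  rw [coe_rootVector2, coe_Z2]
  ext i j
  fin_cases i <;> fin_cases j <;> simp

theorem rePart_cartan_half_neg : rePart (cartan (1 / 2) (-1 / 2)) = Z6 := by
  apply Subtype.ext
  change (cartan (1 / 2) (-1 / 2) : Matrix (Fin 4) (Fin 4) ℂ).map Complex.re = Z6
  rw [coe_cartan, coe_Z6]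
  ext i j
  fin_cases i <;> fin_cases j <;> simp <;> norm_num

theorem rePart_cartan_half_half : rePart (cartan (1 / 2) (1 / 2)) = Z3 := by
  apply Subtype.ext
  change (cartan (1 / 2) (1 / 2) : Matrix (Fin 4) (Fin 4) ℂ).map Complex.re = Z3
  rw [coe_cartan, coe_Z3]
  ext i j
  fin_cases i <;> fin_cases j <;> simp <;> norm_num

theorem imPart_cartan {x₁ x₂ : ℂ} (h₁ : x₁.im = 0) (h₂ : x₂.im = 0) :
    imPart (cartan x₁ x₂) = 0 := by
  apply Subtype.ext
  change (cartan x₁ x₂ : Matrix (Fin 4) (Fin 4) ℂ).map Complex.im = 0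
  rw [coe_cartan]
  ext i j
  fin_cases i <;> fin_cases j <;> simp [h₁, h₂]

variable {V : Type*} [NormedAddCommGroup V] [NormedSpace ℂ V]

/-- The value of the Casimir operator of `𝔰𝔩(2)` on a highest weight vector. -/
theorem casimir_apply_highestWeightVector {A B C : V →L[ℂ] V} (hC : A * B - B * A = C) {v : V}
    (hroot : A v + Complex.I • B v = 0) {m : ℂ} (hw : C v = (-Complex.I * m / 2) • v) :
    (-(A * A) - B * B - C * C) v = (1 / 4 * m * (m + 2)) • v := by
  have hA : A v = -Complex.I • B v := by
    rw [neg_smul]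
    exact eq_neg_of_add_eq_zero_left hroot
  have hB : B v = Complex.I • A v := by
    rw [hA, smul_smul]
    simp
  -- Using `A v = -i B v` for the inner factor of each square turns `A² + B²` into `-i [A, B]` on
  -- `v`. With `C v = -(i m / 2) v`, the first two terms of the Casimir contribute `m / 2` and `-C²`
  -- contributes `m² / 4`.
  have h1 : A (A v) + B (B v) = -Complex.I • C v := by
    have h2 : C v = A (B v) - B (A v) := by
      rw [← hC]
      rfl
    have h3 : A (A v) = -Complex.I • A (B v) := by
      conv_lhs => rw [hA]
      rw [map_smul]
    have h4 : B (B v) = Complex.I • B (A v) := by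
      conv_lhs => rw [hB]
      rw [map_smul]
    rw [h2, h3, h4]
    module
  have h5 : (-(A * A) - B * B - C * C) v = -(A (A v) + B (B v)) - C (C v) := by
    change -(A (A v)) - B (B v) - C (C v) = _
    abel
  rw [h5, h1, hw, map_smul, hw, smul_smul, smul_smul, ← neg_smul, ← sub_smul]
  congr 1
  linear_combination (-(1 / 4) * m * (m + 2)) * Complex.I_sq

variable [FiniteDimensional ℂ V] {τ : Representation ℂ SO4 V}

theorem derivRepC_cartan (hτ : Continuous (op τ)) {x₁ x₂ : ℂ} (h₁ : x₁.im = 0) (h₂ : x₂.im = 0) :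
    derivRepC τ (cartan x₁ x₂) = derivRep τ (rePart (cartan x₁ x₂)) := by
  have h0 : derivRep τ 0 = 0 := by
    rw [← zero_smul ℝ (0 : so (Fin 4) ℝ), derivRep_smul hτ, zero_smul]
  rw [derivRepC, imPart_cartan h₁ h₂, h0, smul_zero, add_zero]

/-- The triple `Z4, Z5, Z6` satisfies `[Z4, Z5] = Z6`, the root vector `Z4 + i Z5` annihilates the
highest weight vector, and `Z6` acts on it by `-i (m₁ - m₂) / 2`. -/
theorem casimir1_eq_smul_one (hτ : IsContIrrep τ) {m₁ m₂ : ℤ} (hm : HasHighestWeight τ m₁ m₂) :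
    casimir1 τ = ((1 / 4 : ℂ) * (m₁ - m₂) * (m₁ - m₂ + 2)) • 1 := by
  have := nontrivial_of_isIrreducible hτ.2
  obtain ⟨v, hv, hw, hroot⟩ := hm
  refine eq_smul_one_of_opConj_eq hτ.2 (opConj_casimir1 hτ.1) hv
    (casimir_apply_highestWeightVector ?_ ?_ ?_)
  · rw [← derivRep_lie hτ.1, lie_Z4_Z5]
  · have h := hroot _ (Or.inl inRootSpace_rootVector1)
    rwa [derivRepC, rePart_rootVector1, imPart_rootVector1] at h
  -- These Cartan coordinates are those of `Z6 = (Y₁ - Y₆) / 2`.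
  · have h := hw (1 / 2) (-1 / 2)
    rw [derivRepC_cartan hτ.1 (by simp) (by simp), rePart_cartan_half_neg] at h
    rw [h, weight]
    congr 1
    ring

theorem casimir2_eq_smul_one (hτ : IsContIrrep τ) {m₁ m₂ : ℤ} (hm : HasHighestWeight τ m₁ m₂) :
    casimir2 τ = ((1 / 4 : ℂ) * (m₁ + m₂) * (m₁ + m₂ + 2)) • 1 := by
  have := nontrivial_of_isIrreducible hτ.2
  obtain ⟨v, hv, hw, hroot⟩ := hm
  refine eq_smul_one_of_opConj_eq hτ.2 (opConj_casimir2 hτ.1) hv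
    (casimir_apply_highestWeightVector ?_ ?_ ?_)
  · rw [← derivRep_lie hτ.1, lie_Z1_Z2]
  · have h := hroot _ (Or.inr inRootSpace_rootVector2)
    rwa [derivRepC, rePart_rootVector2, imPart_rootVector2] at h
  · have h := hw (1 / 2) (1 / 2)
    rw [derivRepC_cartan hτ.1 (by simp) (by simp), rePart_cartan_half_half] at h
    rw [h, weight]
    congr 1
    ring

end HighestWeight

open MeasureTheory

/-! ### Schur orthogonality on `K` and the function `χ` -/

section SchurOrthogonality

instance instIsHaarMeasureHaarSO3 : haarSO3.IsHaarMeasure := by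
  unfold haarSO3
  infer_instance

instance instIsProbabilityMeasureHaarSO3 : IsProbabilityMeasure haarSO3 :=
  ⟨Measure.haarMeasure_self⟩

theorem integrable_haarSO3_of_continuous {E : Type*} [NormedAddCommGroup E] {f : SO3 → E}
    (hf : Continuous f) : Integrable f haarSO3 :=
  hf.integrable_of_hasCompactSupport (HasCompactSupport.of_compactSpace f)

variable {W : Type*} [NormedAddCommGroup W] [NormedSpace ℂ W] [FiniteDimensional ℂ W]

/-- The trace of continuous endomorphisms of a finite-dimensional space. -/
def traceCLM (W : Type*) [NormedAddCommGroup W] [NormedSpace ℂ W] [FiniteDimensional ℂ W] :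
    (W →L[ℂ] W) →L[ℂ] ℂ :=
  LinearMap.toContinuousLinearMap ((LinearMap.trace ℂ W).comp (ContinuousLinearMap.coeLM ℂ))

theorem traceCLM_mul_comm (S T : W →L[ℂ] W) : traceCLM W (S * T) = traceCLM W (T * S) :=
  LinearMap.trace_mul_comm ℂ (S : W →ₗ[ℂ] W) (T : W →ₗ[ℂ] W)

theorem traceCLM_eq_sum {ι : Type*} [Fintype ι] (b : Module.Basis ι ℂ W) (T : W →L[ℂ] W) :
    traceCLM W T = ∑ i, b.coord i (T (b i)) := by
  classical
  change LinearMap.trace ℂ W (T : W →ₗ[ℂ] W) = _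
  rw [LinearMap.trace_eq_matrix_trace ℂ b, Matrix.trace]
  simp [LinearMap.toMatrix_apply]

theorem op_inv_mul_op {G : Type*} [Group G] (π : Representation ℂ G W) (g : G) :
    op π g⁻¹ * op π g = 1 := by
  rw [← op_mul, inv_mul_cancel, op_one]

variable {π : Representation ℂ SO3 W}

theorem continuous_conj_op (hπ : Continuous (op π)) (A : W →L[ℂ] W) :
    Continuous fun k => op π k * A * op π k⁻¹ :=
  (hπ.mul continuous_const).mul (hπ.comp continuous_inv)

/-- The average of the conjugates of an operator under an irreducible representation. -/
theorem finrank_smul_integral_conj_op (hπ : IsContIrrep π) (A : W →L[ℂ] W) :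
    (Module.finrank ℂ W : ℂ) • ∫ k, op π k * A * op π k⁻¹ ∂haarSO3 = traceCLM W A • 1 := by
  have : CompleteSpace W := FiniteDimensional.complete ℂ W
  set I := ∫ k, op π k * A * op π k⁻¹ ∂haarSO3 with hI
  have hint := integrable_haarSO3_of_continuous (continuous_conj_op hπ.1 A)
  have hcomm : ∀ h, op π h * I = I * op π h := by
    intro h
    -- Left invariance of `dk` under `k ↦ h k`.
    have h1 : op π h * I * op π h⁻¹ = I := by
      have h2 := (((ContinuousLinearMap.mul ℂ (W →L[ℂ] W)).flip (op π h⁻¹)).comp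
        (ContinuousLinearMap.mul ℂ (W →L[ℂ] W) (op π h))).integral_comp_comm hint
      have h3 := integral_mul_left_eq_self (μ := haarSO3)
        (fun k => op π k * A * op π k⁻¹) h
      refine Eq.trans ?_ h3
      refine Eq.trans h2.symm ?_
      refine integral_congr_ae (Filter.Eventually.of_forall fun k => ?_)
      simp [op_mul, mul_assoc]
    conv_rhs => rw [← h1]
    rw [mul_assoc, op_inv_mul_op, mul_one]
  obtain ⟨c, hc⟩ := exists_eq_smul_id_of_commute hπ.2 (I : W →ₗ[ℂ] W) fun g => by
    ext w
    exact (congrArg (fun S : W →L[ℂ] W => S w) (hcomm g)).symm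
  have hIc : I = c • 1 := by
    ext w
    exact congrArg (fun S : W →ₗ[ℂ] W => S w) hc
  -- Taking traces determines the Schur constant `c`, since conjugation preserves the trace and the
  -- measure has mass `1`.
  have htr : traceCLM W I = traceCLM W A := by
    rw [hI, ← (traceCLM W).integral_comp_comm hint]
    have h4 : ∀ k, traceCLM W (op π k * A * op π k⁻¹) = traceCLM W A := by
      intro k
      rw [traceCLM_mul_comm, ← mul_assoc, op_inv_mul_op, one_mul]
    simp [h4]
  have htr1 : traceCLM W 1 = Module.finrank ℂ W := LinearMap.trace_one ℂ W
  rw [← htr, hIc, map_smul, htr1, smul_smul, smul_eq_mul, mul_comm]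

theorem character_eq_traceCLM (k : SO3) : π.character k = traceCLM W (op π k) := rfl

/-- In a basis, the product of the two traces is a double sum of matrix coefficients of `π(k) E_ij
π(k⁻¹)`, where `E_ij` is a matrix unit. Averaging over `K` replaces each conjugate by `tr(E_ij) /
dim W`, so only the diagonal terms survive and they add up to `tr T`. -/
theorem finrank_mul_integral_character_mul_trace (hπ : IsContIrrep π) (T : W →L[ℂ] W) :
    (Module.finrank ℂ W : ℂ) * ∫ k, π.character k⁻¹ * traceCLM W (T * op π k) ∂haarSO3 =
      traceCLM W T := by
  have : CompleteSpace W := FiniteDimensional.complete ℂ W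
  let b := Module.finBasis ℂ W
  let E : Fin (Module.finrank ℂ W) → Fin (Module.finrank ℂ W) → W →L[ℂ] W := fun i j =>
    LinearMap.toContinuousLinearMap ((b.coord j).smulRight (b i))
  let L : Fin (Module.finrank ℂ W) → Fin (Module.finrank ℂ W) → (W →L[ℂ] W) →L[ℂ] ℂ := fun i j =>
    (LinearMap.toContinuousLinearMap (b.coord i)) ∘L T ∘L (ContinuousLinearMap.apply ℂ W (b j))
  have htrE : ∀ i j, traceCLM W (E i j) = if i = j then 1 else 0 := by
    intro i j
    rw [traceCLM_eq_sum b, Finset.sum_eq_single j]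
    · simp [E, Finsupp.single_apply]
    · intro x _ hx
      simp [E, hx]
    · simp
  have hL : ∀ i j S, L i j S = b.coord i (T (S (b j))) := fun _ _ _ => rfl
  have hint : ∀ i j, Integrable (fun k => L i j (op π k * E i j * op π k⁻¹)) haarSO3 := fun i j =>
    integrable_haarSO3_of_continuous ((L i j).continuous.comp (continuous_conj_op hπ.1 _))
  have hk : ∀ k, π.character k⁻¹ * traceCLM W (T * op π k) =
      ∑ i, ∑ j, L i j (op π k * E i j * op π k⁻¹) := by
    intro k
    rw [character_eq_traceCLM, traceCLM_eq_sum b, traceCLM_eq_sum b, mul_comm, Finset.sum_mul_sum]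
    refine Finset.sum_congr rfl fun i _ => Finset.sum_congr rfl fun j _ => ?_
    simp [hL, E, mul_comm]
  simp_rw [hk]
  rw [integral_finsetSum _ fun i _ => integrable_finsetSum _ fun j _ => hint i j]
  have h1 : ∀ i, ∫ k, ∑ j, L i j (op π k * E i j * op π k⁻¹) ∂haarSO3 =
      ∑ j, L i j (∫ k, op π k * E i j * op π k⁻¹ ∂haarSO3) := by
    intro i
    rw [integral_finsetSum _ fun j _ => hint i j]
    refine Finset.sum_congr rfl fun j _ => ?_
    exact (L i j).integral_comp_comm
      (integrable_haarSO3_of_continuous (continuous_conj_op hπ.1 (E i j)))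
  have h2 : ∀ i j, (Module.finrank ℂ W : ℂ) * L i j (∫ k, op π k * E i j * op π k⁻¹ ∂haarSO3) =
      L i j ((if i = j then (1 : ℂ) else 0) • 1) := by
    intro i j
    rw [← smul_eq_mul, ← map_smul, finrank_smul_integral_conj_op hπ, htrE]
  simp_rw [h1, Finset.mul_sum, h2]
  rw [traceCLM_eq_sum b]
  refine Finset.sum_congr rfl fun i _ => ?_
  rw [Finset.sum_eq_single i]
  · simp [hL]
  · intro j _ hj
    simp [hj.symm]
  · simp

theorem continuous_chi (hπ : Continuous (op π)) : Continuous (chi π) :=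
  continuous_const.mul ((traceCLM W).continuous.comp hπ)

/-- The function `χ_δ` is idempotent under convolution. -/
theorem integral_chi_inv_mul_chi_mul (hπ : IsContIrrep π) (h : SO3) :
    ∫ k, chi π k⁻¹ * chi π (h * k) ∂haarSO3 = chi π h := by
  have h1 := finrank_mul_integral_character_mul_trace hπ (op π h)
  have h2 : ∀ k, chi π k⁻¹ * chi π (h * k) = (Module.finrank ℂ W : ℂ) *
      ((Module.finrank ℂ W : ℂ) * (π.character k⁻¹ * traceCLM W (op π h * op π k))) := by
    intro k
    rw [chi, chi, character_eq_traceCLM (h * k), op_mul]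
    ring
  simp_rw [h2]
  rw [integral_const_mul, integral_const_mul, h1]
  rfl

end SchurOrthogonality

section Projection

variable {V : Type*} [NormedAddCommGroup V] [NormedSpace ℂ V] [FiniteDimensional ℂ V]
variable {τ : Representation ℂ SO4 V}
variable {W : Type*} [NormedAddCommGroup W] [NormedSpace ℂ W] [FiniteDimensional ℂ W]
variable {π : Representation ℂ SO3 W}

theorem continuous_incl : Continuous incl := by
  refine Continuous.subtype_mk ?_ _
  exact (Continuous.matrix_fromBlocks continuous_subtype_val continuous_const continuous_const
    continuous_const).matrix_submatrix _ _

theorem integrable_chi_smul_op (hπ : Continuous (op π)) (hτ : Continuous (op τ)) :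
    Integrable (fun k => chi π k⁻¹ • op τ (incl k)) haarSO3 :=
  integrable_haarSO3_of_continuous
    (((continuous_chi hπ).comp continuous_inv).smul (hτ.comp continuous_incl))

end Projection

/-! ### Invariant differential operators applied to matrix coefficients -/

section Operators

variable {V : Type*} [NormedAddCommGroup V] [NormedSpace ℂ V] [FiniteDimensional ℂ V]
variable {τ : Representation ℂ SO4 V}
variable {F : Type*} [NormedAddCommGroup F] [NormedSpace ℂ F]

/-- The right factor `B` makes the class of functions stable under differentiation, so that the rule
can be iterated. -/
theorem leftInvDeriv_clm_comp (hτ : Continuous (op τ)) (R : (V →L[ℂ] V) →L[ℂ] F)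
    (X : LieAlgebra.Orthogonal.so (Fin 4) ℝ) (B : V →L[ℂ] V) :
    leftInvDeriv X (fun g => R (op τ g * B)) = fun g => R (op τ g * (derivRep τ X * B)) := by
  funext g
  have h := ((hasDerivAt_op_expSO4_smul hτ X).mul_const B).const_mul (op τ g)
  have h2 := (R.hasFDerivAt.restrictScalars ℝ).comp_hasDerivAt (0 : ℝ) h
  simp only [leftInvDeriv, op_mul, mul_assoc]
  exact h2.deriv

theorem leftInvDeriv_leftInvDeriv_clm_comp (hτ : Continuous (op τ)) (R : (V →L[ℂ] V) →L[ℂ] F)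
    (X : LieAlgebra.Orthogonal.so (Fin 4) ℝ) (g : SO4) :
    leftInvDeriv X (leftInvDeriv X fun g => R (op τ g)) g =
      R (op τ g * (derivRep τ X * derivRep τ X)) := by
  have h : (fun g => R (op τ g)) = fun g => R (op τ g * 1) := by simp only [mul_one]
  rw [h, leftInvDeriv_clm_comp hτ, leftInvDeriv_clm_comp hτ, mul_one]

theorem Delta1_clm_comp (hτ : Continuous (op τ)) (R : (V →L[ℂ] V) →L[ℂ] F) (g : SO4) :
    Delta1 (fun g => R (op τ g)) g = R (op τ g * casimir1 τ) := by
  simp only [Delta1, leftInvDeriv_leftInvDeriv_clm_comp hτ, casimir1, mul_sub, mul_neg, map_sub,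
    map_neg]

theorem Delta2_clm_comp (hτ : Continuous (op τ)) (R : (V →L[ℂ] V) →L[ℂ] F) (g : SO4) :
    Delta2 (fun g => R (op τ g)) g = R (op τ g * casimir2 τ) := by
  simp only [Delta2, leftInvDeriv_leftInvDeriv_clm_comp hτ, casimir2, mul_sub, mul_neg, map_sub,
    map_neg]

theorem isSmooth_clm_comp [Nontrivial V] (hτ : Continuous (op τ)) (R : (V →L[ℂ] V) →L[ℂ] F) :
    IsSmooth fun g => R (op τ g) := by
  intro g
  simp only [op_mul]
  have h : ContDiff ℂ ∞ (R.comp (ContinuousLinearMap.mul ℂ (V →L[ℂ] V) (op τ g))) :=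
    ContinuousLinearMap.contDiff _
  exact (h.restrict_scalars ℝ).comp (contDiff_op_expSO4 hτ)

variable {W : Type*} [NormedAddCommGroup W] [NormedSpace ℂ W] [FiniteDimensional ℂ W]
variable {π : Representation ℂ SO3 W}

theorem integral_chi_smul_clm_comp [CompleteSpace F] (hπ : Continuous (op π))
    (hτ : Continuous (op τ)) (R : (V →L[ℂ] V) →L[ℂ] F) (x y : SO4) :
    ∫ k, chi π k⁻¹ • R (op τ (x * incl k * y)) ∂haarSO3 =
      R (op τ x * isoProj π τ * op τ y) := by
  have : CompleteSpace V := FiniteDimensional.complete ℂ V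
  have h := (R.comp (((ContinuousLinearMap.mul ℂ (V →L[ℂ] V)).flip (op τ y)).comp
    (ContinuousLinearMap.mul ℂ (V →L[ℂ] V) (op τ x)))).integral_comp_comm
      (integrable_chi_smul_op hπ hτ)
  refine Eq.trans (integral_congr_ae (Filter.Eventually.of_forall fun k => ?_)) h
  simp [op_mul]

end Operators

/-! ### The isotypic projection and the spherical function -/

section Spherical

variable {V : Type*} [NormedAddCommGroup V] [NormedSpace ℂ V] [FiniteDimensional ℂ V]
variable {τ : Representation ℂ SO4 V}

/-- The compression of an operator of `V` to the isotypic component. -/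
def compression {W : Type*} [NormedAddCommGroup W] [NormedSpace ℂ W]
    (π : Representation ℂ SO3 W) (τ : Representation ℂ SO4 V) :
    (V →L[ℂ] V) →L[ℂ] (isoComp π τ →L[ℂ] isoComp π τ) :=
  (ContinuousLinearMap.compL ℂ (isoComp π τ) V (isoComp π τ)
    ((isoProj π τ).codRestrict (isoComp π τ) fun v => ⟨v, rfl⟩)) ∘L
    ((ContinuousLinearMap.compL ℂ (isoComp π τ) V V).flip (isoComp π τ).subtypeL)

theorem sphericalFunction_eq {W : Type*} [NormedAddCommGroup W] [NormedSpace ℂ W]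
    {π : Representation ℂ SO3 W} :
    sphericalFunction π τ = fun g => compression π τ (op τ g) := rfl

variable {W : Type*} [NormedAddCommGroup W] [NormedSpace ℂ W] [FiniteDimensional ℂ W]
variable {π : Representation ℂ SO3 W}

/-- Left invariance gives `τ(k) P = ∫ χ(h⁻¹ k) τ(h) dh`. After exchanging the integrals, the inner
one is the convolution of `χ` with itself at `h⁻¹`, which is `χ(h⁻¹)`. -/
theorem isoProj_mul_isoProj (hπ : IsContIrrep π) (hτ : Continuous (op τ)) :
    isoProj π τ * isoProj π τ = isoProj π τ := by
  have : CompleteSpace V := FiniteDimensional.complete ℂ V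
  have hint := integrable_chi_smul_op hπ.1 hτ
  have h1 : ∀ k, op τ (incl k) * isoProj π τ = ∫ h, chi π (h⁻¹ * k) • op τ (incl h) ∂haarSO3 := by
    intro k
    refine Eq.trans
      ((ContinuousLinearMap.mul ℂ (V →L[ℂ] V) (op τ (incl k))).integral_comp_comm hint).symm ?_
    refine Eq.trans ?_ (integral_mul_left_eq_self (μ := haarSO3)
      (fun h => chi π (h⁻¹ * k) • op τ (incl h)) k)
    refine integral_congr_ae (Filter.Eventually.of_forall fun h => ?_)
    simp [op_mul]
  have h2 : isoProj π τ * isoProj π τ =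
      ∫ k, chi π k⁻¹ • (op τ (incl k) * isoProj π τ) ∂haarSO3 := by
    refine Eq.trans (((ContinuousLinearMap.mul ℂ (V →L[ℂ] V)).flip
      (isoProj π τ)).integral_comp_comm hint).symm ?_
    refine integral_congr_ae (Filter.Eventually.of_forall fun h => ?_)
    simp
  rw [h2]
  simp_rw [h1, ← integral_smul]
  rw [integral_integral_swap_of_hasCompactSupport]
  · simp_rw [smul_smul, integral_smul_const, integral_chi_inv_mul_chi_mul hπ]
    rfl
  · have hc := continuous_chi hπ.1
    have hi := hτ.comp continuous_incl
    exact (hc.comp continuous_fst.inv).smul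
      ((hc.comp (continuous_snd.inv.mul continuous_fst)).smul (hi.comp continuous_snd))
  · exact HasCompactSupport.of_compactSpace _

theorem compression_one (hπ : IsContIrrep π) (hτ : Continuous (op τ)) : compression π τ 1 = 1 := by
  ext v
  -- A vector of the isotypic component is `P w`, so the claim is `P (P w) = P w`.
  obtain ⟨v, w, rfl⟩ := v
  exact congrArg (fun S : V →L[ℂ] V => S w) (isoProj_mul_isoProj hπ hτ)

theorem isSphericalFunction_sphericalFunction (hπ : IsContIrrep π) (hτ : Continuous (op τ)) :
    IsSphericalFunction π (sphericalFunction π τ) := by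
  have : CompleteSpace (isoComp π τ) := FiniteDimensional.complete ℂ _
  refine ⟨(compression π τ).continuous.comp hτ, ?_, fun x y => ?_⟩
  · change compression π τ (op τ 1) = 1
    rw [op_one, compression_one hπ hτ]
  -- The compression of `τ(x) P τ(y)` is `P τ(x) P τ(y)` on `V(ℓ)`, which is `Φ(x) Φ(y)` by
  -- definition.
  · exact (integral_chi_smul_clm_comp (F := isoComp π τ →L[ℂ] isoComp π τ) hπ.1 hτ
      (compression π τ) x y).symm

end Spherical

section SphericalOperators

variable {V : Type*} [NormedAddCommGroup V] [NormedSpace ℂ V] [FiniteDimensional ℂ V]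
variable {τ : Representation ℂ SO4 V}
variable {W : Type*} [NormedAddCommGroup W] [NormedSpace ℂ W] {π : Representation ℂ SO3 W}

theorem isSmooth_sphericalFunction (hτ : IsContIrrep τ) : IsSmooth (sphericalFunction π τ) := by
  have := nontrivial_of_isIrreducible hτ.2
  rw [sphericalFunction_eq]
  exact isSmooth_clm_comp (F := isoComp π τ →L[ℂ] isoComp π τ) hτ.1 (compression π τ)

theorem Delta1_sphericalFunction (hτ : Continuous (op τ)) (g : SO4) :
    Delta1 (sphericalFunction π τ) g = compression π τ (op τ g * casimir1 τ) := by
  have h := Delta1_clm_comp (F := isoComp π τ →L[ℂ] isoComp π τ) hτ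
  have h' := h (compression π τ) g
  exact h'

theorem Delta2_sphericalFunction (hτ : Continuous (op τ)) (g : SO4) :
    Delta2 (sphericalFunction π τ) g = compression π τ (op τ g * casimir2 τ) := by
  have h := Delta2_clm_comp (F := isoComp π τ →L[ℂ] isoComp π τ) hτ
  have h' := h (compression π τ) g
  exact h'

end SphericalOperators

end SphericalSO4

end

theorem mainTheorem4
    {V : Type*} [NormedAddCommGroup V] [NormedSpace ℂ V] [FiniteDimensional ℂ V]
    {W : Type*} [NormedAddCommGroup W] [NormedSpace ℂ W] [FiniteDimensional ℂ W]
    (ℓ : ℕ) (hℓ : Even ℓ) (m₁ m₂ : ℤ) (hm₁ : (ℓ : ℝ) / 2 ≤ m₁) (hm₂ : |(m₂ : ℝ)| ≤ (ℓ : ℝ) / 2)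
    (π : Representation ℂ SphericalSO4.SO3 W) (hπ : SphericalSO4.IsContIrrep π)
    (hπℓ : SphericalSO4.IsPi ℓ π)
    (τ : Representation ℂ SphericalSO4.SO4 V) (hτ : SphericalSO4.IsContIrrep τ)
    (hτm : SphericalSO4.HasHighestWeight τ m₁ m₂) :
    SphericalSO4.IsSphericalFunction π (SphericalSO4.sphericalFunction π τ) ∧
    SphericalSO4.IsSmooth (SphericalSO4.sphericalFunction π τ) ∧
    (∀ g : SphericalSO4.SO4,
      SphericalSO4.Delta1 (SphericalSO4.sphericalFunction π τ) g =
        ((1 / 4 : ℂ) * (m₁ - m₂) * (m₁ - m₂ + 2)) • SphericalSO4.sphericalFunction π τ g) ∧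
    ∀ g : SphericalSO4.SO4,
      SphericalSO4.Delta2 (SphericalSO4.sphericalFunction π τ) g =
        ((1 / 4 : ℂ) * (m₁ + m₂) * (m₁ + m₂ + 2)) • SphericalSO4.sphericalFunction π τ g := by
  refine ⟨SphericalSO4.isSphericalFunction_sphericalFunction hπ hτ.1,
    SphericalSO4.isSmooth_sphericalFunction hτ, fun g => ?_, fun g => ?_⟩
  · rw [SphericalSO4.Delta1_sphericalFunction hτ.1, SphericalSO4.casimir1_eq_smul_one hτ hτm,
      mul_smul_comm, mul_one, map_smul, SphericalSO4.sphericalFunction_eq]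
  · rw [SphericalSO4.Delta2_sphericalFunction hτ.1, SphericalSO4.casimir2_eq_smul_one hτ hτm,
      mul_smul_comm, mul_one, map_smul, SphericalSO4.sphericalFunction_eq]
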